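/- **Setting.** Let $(V,Q)$ be a non-degenerate finite-dimensional rational quadratic space of signature $(b^+,b^-)$ with bilinear form $(X,Y)=Q(X+Y)-Q(X)-Q(Y)$, let $L\subset V$ be an even lattice of full rank (i.e. $Q(L)\subset\mathbb Z$), $L'$ its dual lattice, and $(\mathfrak e_\gamma)_{\gamma\in L'/L}$ the standard basis of $\mathbb C[L'/L]$. Write $e(z)=e^{2\pi i z}$ and $\tau=x+iy\in\mathbb H$. Let $\mathrm{Mp}_2(\mathbb Z)$ be the group of pairs $(M,\phi)$ with $M=\begin{pmatrix}a&b\\c&d\end{pmatrix}\in\mathrm{SL}_2(\mathbb Z)$ and $\phi:\mathbb H\to\mathbb C$ holomorphic with $\phi(\tau)^2=c\tau+d$, with product $(M,\phi(\tau))(M',\phi'(\tau))=(MM',\phi(M'\tau)\phi'(\tau))$. It is generated by $T=\left(\begin{pmatrix}1&1\\0&1\end{pmatrix},1\right)$ and $S=\left(\begin{pmatrix}0&-1\\1&0\end{pmatrix},\sqrt\tau\right)$. The Weil representation $\rho_L$ is the unitary representation of $\mathrm{Mp}_2(\mathbb Z)$ on $\mathbb C[L'/L]$ with $$\rho_L(T)\mathfrak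 e_\gamma=e(Q(\gamma))\mathfrak e_\gamma,\qquad \rho_L(S)\mathfrak e_\gamma=\frac{e((b^--b^+)/8)}{\sqrt{|L'/L|}}\sum_{\delta\in L'/L}e(-(\gamma,\delta))\mathfrak e_\delta ,$$ and $\bar\rho_L$ is its dual representation. Let $\rho\in\{\rho_L,\bar\rho_L\}$, and put $Q_\rho=Q$ if $\rho=\rho_L$, $Q_\rho=-Q$ if $\rho=\bar\rho_L$. For an integer $k$, let $H_{k,\rho}$ be the space of smooth $f:\mathbb H\to\mathbb C[L'/L]$ such that (i) $f(M\tau)=\phi(\tau)^{2k}\rho(M,\phi)f(\tau)$ for all $(M,\phi)\in\mathrm{Mp}_2(\mathbb Z)$; (ii) $\Delta_kf=0$, where $\Delta_k=-y^2\left(\frac{\partial^2}{\partial x^2}+\frac{\partial^2}{\partial y^2}\right)+iky\left(\frac{\partial}{\partial x}+i\frac{\partial}{\partial y}\right)$; (iii) there is a finite sum $P_f(\tau)=\sum_{\gamma}\sum_{n\in\mathbb Z+Q_\rho(\gamma),\,n\le0}c(\gamma,n)e(n\tau)\mathfrak e_\gamma$ with $f(\tau)=P_f(\tau)+O(e^{-\varepsilon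 y})$ as $y\to\infty$, uniformly in $x$, for some $\varepsilon>0$. Let $M^!_{k,\rho}$ be the space of holomorphic $g:\mathbb H\to\mathbb C[L'/L]$ satisfying (i) and having a Fourier expansion $$g(\tau)=\sum_{\gamma}\sum_{n\in\mathbb Z+Q_\rho(\gamma),\ n\gg-\infty}c_g(\gamma,n)e(n\tau)\mathfrak e_\gamma .$$ Let $D=\frac1{2\pi i}\frac{\partial}{\partial\tau}$ with $\frac{\partial}{\partial\tau}=\frac12\left(\frac{\partial}{\partial x}-i\frac{\partial}{\partial y}\right)$, and $\Gamma(a,x)=\int_x^\infty e^{-t}t^{a-1}\,dt$. **Theorem.** Let $k\le0$ be an integer, $f\in H_{k,\rho_L}$ and $g\in D^{1-k}(H_{k,\bar\rho_L})$. Then $g\in M^!_{2-k,\bar\rho_L}$, the form $f$ has a decomposition $$f(\tau)=\sum_{\gamma}\sum_{n\in\mathbb Z+Q(\gamma),\ n\gg-\infty}c_f^+(\gamma,n)e(n\tau)\mathfrak e_\gamma+\sum_{\gamma}\sum_{n\in\mathbb Z+Q(\gamma),\ n<0}c_f^-(\gamma,n)\Gamma(1-k,4\pi|n|y)e(n\tau)\mathfrak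 e_\gamma ,$$ and for the coefficients $c_f^+$ of any such decomposition and the Fourier coefficients $c_g$ of $g$ one has $$\sum_{\gamma\in L'/L}\ \sum_{m+n=0}c_f^+(\gamma,m)\,c_g(\gamma,n)=0 .$$ (The inner sum has only finitely many non-zero terms.) -/

import Mathlib

open scoped MatrixGroups UpperHalfPlane Manifold ContDiff Asymptotics
open UpperHalfPlane

noncomputable section

/-- The integral metaplectic group `Mp₂(ℤ)`: pairs `(M, φ)` with `M ∈ SL₂(ℤ)` and
`φ : ℍ → ℂ` holomorphic such that `φ(τ)² = cτ + d`. -/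
@[ext]
structure Mp2Z where
  mat : SL(2, ℤ)
  phi : ℍ → ℂ
  holo : MDifferentiable 𝓘(ℂ) 𝓘(ℂ) phi
  sq : ∀ τ : ℍ, phi τ ^ 2 = denom mat τ

namespace Mp2Z

theorem phi_ne_zero (g : Mp2Z) (τ : ℍ) : g.phi τ ≠ 0 := by
  intro h
  have := g.sq τ
  rw [h] at this
  exact denom_ne_zero _ τ (by rw [← this]; ring)

theorem mdiff_smul (M : SL(2, ℤ)) : MDifferentiable 𝓘(ℂ) 𝓘(ℂ) (fun τ : ℍ => M • τ) :=
  mdifferentiable_smul (g := (M : GL (Fin 2) ℝ)) (by simp)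

theorem denom_mul (M N : SL(2, ℤ)) (τ : ℍ) :
    denom (M * N : SL(2, ℤ)) τ = denom M ↑(N • τ) * denom N τ := by
  have := denom_cocycle_σ (M : GL (Fin 2) ℝ) (N : GL (Fin 2) ℝ) τ
  rw [σ, if_pos (by simp)] at this
  simpa using this

/-- `(M, φ(τ)) (M', φ'(τ)) = (M M', φ(M'τ) φ'(τ))`. -/
instance : Mul Mp2Z where
  mul g h :=
    { mat := g.mat * h.mat
      phi := fun τ => g.phi (h.mat • τ) * h.phi τ
      holo := (g.holo.comp (mdiff_smul h.mat)).mul h.holo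
      sq := fun τ => by rw [mul_pow, g.sq, h.sq, denom_mul] }

instance : One Mp2Z where
  one :=
    { mat := 1
      phi := fun _ => 1
      holo := mdifferentiable_const
      sq := fun τ => by simp [denom] }

instance : Inv Mp2Z where
  inv g :=
    { mat := g.mat⁻¹
      phi := fun τ => (g.phi (g.mat⁻¹ • τ))⁻¹
      holo := by
        have h := g.holo.comp (mdiff_smul g.mat⁻¹)
        rw [mdifferentiable_iff] at h ⊢
        exact h.inv fun z _ => g.phi_ne_zero _
      sq := fun τ => by
        have h := denom_mul g.mat g.mat⁻¹ τ
        rw [mul_inv_cancel] at h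
        have h1 : denom ((1 : SL(2, ℤ)) : GL (Fin 2) ℝ) τ = 1 := by simp [denom]
        rw [h1] at h
        rw [inv_pow, g.sq]
        exact (eq_inv_of_mul_eq_one_right h.symm).symm }

theorem mul_mat (g h : Mp2Z) : (g * h).mat = g.mat * h.mat := rfl
theorem mul_phi (g h : Mp2Z) (τ : ℍ) : (g * h).phi τ = g.phi (h.mat • τ) * h.phi τ := rfl
theorem one_mat : (1 : Mp2Z).mat = 1 := rfl
theorem one_phi (τ : ℍ) : (1 : Mp2Z).phi τ = 1 := rfl
theorem inv_mat (g : Mp2Z) : g⁻¹.mat = g.mat⁻¹ := rfl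
theorem inv_phi (g : Mp2Z) (τ : ℍ) : g⁻¹.phi τ = (g.phi (g.mat⁻¹ • τ))⁻¹ := rfl

instance : Group Mp2Z :=
  Group.ofLeftAxioms
    (fun a b c => by
      ext τ
      · simp only [mul_mat, mul_assoc]
      · simp only [mul_phi, mul_mat, mul_assoc, mul_smul])
    (fun a => by
      ext τ
      · simp only [mul_mat, one_mat, one_mul]
      · simp only [mul_phi, one_phi, one_mul])
    (fun a => by
      ext τ
      · simp only [mul_mat, inv_mat, one_mat, inv_mul_cancel]
      · simp only [mul_phi, inv_phi, one_phi, inv_smul_smul]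
        exact inv_mul_cancel₀ (a.phi_ne_zero τ))

/-- `T = ((1 1; 0 1), 1)`. -/
def T : Mp2Z where
  mat := ModularGroup.T
  phi := fun _ => 1
  holo := mdifferentiable_const
  sq := fun τ => by simp [denom, ModularGroup.coe_T]

/-- `S = ((0 -1; 1 0), √τ)`, with the principal branch of the square root. -/
def S : Mp2Z where
  mat := ModularGroup.S
  phi := fun τ => (τ : ℂ) ^ (1 / 2 : ℂ)
  holo := by
    rw [mdifferentiable_iff]
    intro z hz
    have h : DifferentiableAt ℂ (fun w : ℂ => w ^ (1 / 2 : ℂ)) z :=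
      differentiableAt_id.cpow_const (Or.inr (ne_of_gt hz))
    refine (h.differentiableWithinAt).congr (fun w hw => ?_) ?_
    · simp [Function.comp, ofComplex_apply_of_im_pos hw]
    · simp [Function.comp, ofComplex_apply_of_im_pos hz]
  sq := fun τ => by
    rw [← Complex.cpow_nat_mul]
    simp [denom, ModularGroup.coe_S]

theorem closure_S_T : Subgroup.closure {S, T} = (⊤ : Subgroup Mp2Z) := by
  have hS2 : ∀ τ : ℍ, (S * S).mat • τ = τ := fun τ => by
    have h : (S * S).mat = -1 := by
      rw [mul_mat]
      ext i j
      fin_cases i <;> fin_cases j <;> simp [S, ModularGroup.coe_S, Matrix.mul_apply]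
    rw [h, ModularGroup.SL_neg_smul, one_smul]
  have hS4 : ∀ τ : ℍ, ((S * S) * (S * S)).phi τ = -1 := fun τ => by
    rw [mul_phi, hS2, ← pow_two, (S * S).sq, mul_mat]
    simp [S, denom, ModularGroup.coe_S, Matrix.mul_apply]
  have hS4' : ((S * S) * (S * S)).mat = 1 := by
    simp only [mul_mat]
    ext i j
    fin_cases i <;> fin_cases j <;> simp [S, ModularGroup.coe_S, Matrix.mul_apply]
  have hSm : S ∈ Subgroup.closure {S, T} := Subgroup.subset_closure (by simp)
  have hTm : T ∈ Subgroup.closure {S, T} := Subgroup.subset_closure (by simp)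
  let π : Mp2Z →* SL(2, ℤ) := ⟨⟨Mp2Z.mat, rfl⟩, fun _ _ => rfl⟩
  have hπ : (Subgroup.closure {S, T}).map π = ⊤ := by
    rw [MonoidHom.map_closure, Set.image_pair]
    exact SpecialLinearGroup.SL2Z_generators
  rw [eq_top_iff]
  intro g _
  obtain ⟨h, hh, hgh⟩ : g.mat ∈ (Subgroup.closure {S, T}).map π := by rw [hπ]; trivial
  have hmat : h.mat = g.mat := hgh
  have hsq : Set.EqOn (g.phi ^ 2) (h.phi ^ 2) Set.univ := fun τ _ => by
    simp only [Pi.pow_apply, g.sq, h.sq, hmat]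
  rcases isPreconnected_univ.eq_or_eq_neg_of_sq_eq g.holo.continuous.continuousOn
    h.holo.continuous.continuousOn hsq (fun {τ} _ => h.phi_ne_zero τ) with e | e
  · have : g = h := by
      ext1
      · exact hmat.symm
      · exact funext fun τ => e (Set.mem_univ τ)
    rwa [this]
  · have : g = ((S * S) * (S * S)) * h := by
      ext1
      · rw [mul_mat, hS4', one_mul, hmat]
      · funext τ
        rw [mul_phi, hS4, e (Set.mem_univ τ)]
        simp
    rw [this]
    exact mul_mem (mul_mem (mul_mem hSm hSm) (mul_mem hSm hSm)) hh

end Mp2Z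

/-- `e(x) = exp(2πix)` for rational `x`. -/
def expUnit (x : ℚ) : ℂ := Complex.exp (2 * Real.pi * Complex.I * (x : ℂ))

theorem expUnit_add (x y : ℚ) : expUnit (x + y) = expUnit x * expUnit y := by
  rw [expUnit, expUnit, expUnit, ← Complex.exp_add]; push_cast; ring_nf

theorem expUnit_neg (x : ℚ) : expUnit (-x) = star (expUnit x) := by
  rw [expUnit, expUnit, Complex.star_def, ← Complex.exp_conj]
  congr 1
  simp only [map_mul, Complex.conj_ofReal, Complex.conj_I, map_ratCast, Rat.cast_neg, map_ofNat]
  ring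

theorem expUnit_eq_one_iff (x : ℚ) : expUnit x = 1 ↔ ∃ n : ℤ, x = n := by
  rw [expUnit, Complex.exp_eq_one_iff]
  refine exists_congr fun n => ?_
  have h : (2 * Real.pi * Complex.I : ℂ) ≠ 0 := Complex.two_pi_I_ne_zero
  rw [mul_comm (n : ℂ), mul_right_inj' h]
  exact_mod_cast Iff.rfl

theorem expUnit_zero : expUnit 0 = 1 := by simp [expUnit]

theorem expUnit_mul_star (x : ℚ) : expUnit x * star (expUnit x) = 1 := by
  rw [← expUnit_neg, ← expUnit_add, add_neg_cancel, expUnit_zero]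

/-- A full even lattice `L` in a non-degenerate rational quadratic space `(V, Q)`;
evenness means that `Q` is integral on `L`. The bilinear form is
`(x, y) = Q(x + y) - Q(x) - Q(y)`. -/
structure EvenLattice (V : Type*) [AddCommGroup V] [Module ℚ V] where
  Q : QuadraticForm ℚ V
  L : Submodule ℤ V
  nondegenerate : Q.polarBilin.Nondegenerate
  fg : L.FG
  span_eq_top : Submodule.span ℚ (L : Set V) = ⊤
  even : ∀ x ∈ L, ∃ n : ℤ, Q x = n

namespace EvenLattice

variable {V : Type*} [AddCommGroup V] [Module ℚ V] (Λ : EvenLattice V)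

/-- The bilinear form `(x, y) = Q(x + y) - Q(x) - Q(y)`. -/
def pair (x y : V) : ℚ := QuadraticMap.polar Λ.Q x y

/-- The dual lattice `L'`. -/
def dual : Submodule ℤ V := LinearMap.BilinForm.dualSubmodule Λ.Q.polarBilin Λ.L

/-- The discriminant group `L'/L`. -/
abbrev Disc : Type _ := Λ.dual ⧸ Λ.L.submoduleOf Λ.dual

theorem mem_dual {x : V} : x ∈ Λ.dual ↔ ∀ y ∈ Λ.L, ∃ n : ℤ, Λ.pair x y = n := by
  refine forall₂_congr fun y _ => ?_
  rw [Submodule.mem_one]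
  exact exists_congr fun n => by simp [pair, eq_comm]

theorem pair_add_left (x x' y : V) : Λ.pair (x + x') y = Λ.pair x y + Λ.pair x' y :=
  QuadraticMap.polar_add_left Λ.Q x x' y

theorem pair_comm (x y : V) : Λ.pair x y = Λ.pair y x := QuadraticMap.polar_comm Λ.Q x y

theorem pair_add_right (x y y' : V) : Λ.pair x (y + y') = Λ.pair x y + Λ.pair x y' :=
  QuadraticMap.polar_add_right Λ.Q x y y'

theorem le_dual : Λ.L ≤ Λ.dual := fun x hx => by
  rw [mem_dual]
  intro y hy
  obtain ⟨a, ha⟩ := Λ.even _ (add_mem hx hy)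
  obtain ⟨b, hb⟩ := Λ.even _ hx
  obtain ⟨c, hc⟩ := Λ.even _ hy
  exact ⟨a - b - c, by simp [pair, QuadraticMap.polar, ha, hb, hc]⟩

theorem exists_basis : ∃ (n : ℕ) (b : Module.Basis (Fin n) ℚ V),
    Submodule.span ℤ (Set.range b) = Λ.L := by
  have : Module.Finite ℤ Λ.L := Module.Finite.iff_fg.mpr Λ.fg
  have : IsAddTorsionFree V := .of_module_rat V
  have : Module.IsTorsionFree ℤ V := inferInstance
  have : Module.Free ℤ Λ.L := inferInstance
  let b := Module.finBasis ℤ Λ.L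
  have hspan : Submodule.span ℤ (Set.range fun i => (b i : V)) = Λ.L := by
    have := congrArg (Submodule.map Λ.L.subtype) b.span_eq
    rw [Submodule.map_span, ← Set.range_comp, Submodule.map_top, Submodule.range_subtype] at this
    exact this
  have hli : LinearIndependent ℚ fun i => (b i : V) := by
    rw [← LinearIndependent.iff_fractionRing ℤ ℚ]
    exact b.linearIndependent.map' Λ.L.subtype (Submodule.ker_subtype _)
  have hsp : ⊤ ≤ Submodule.span ℚ (Set.range fun i => (b i : V)) := by
    rw [← Submodule.span_span_of_tower ℤ, hspan, Λ.span_eq_top]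
  refine ⟨_, Module.Basis.mk hli hsp, ?_⟩
  rw [Module.Basis.coe_mk, hspan]

theorem mem_of_pair_dual {x : V} (h : ∀ y ∈ Λ.dual, ∃ n : ℤ, Λ.pair x y = n) : x ∈ Λ.L := by
  obtain ⟨n, b, hb⟩ := Λ.exists_basis
  have hs : LinearMap.BilinForm.IsSymm Λ.Q.polarBilin :=
    ⟨fun x y => by simpa using! QuadraticMap.polar_comm Λ.Q x y⟩
  have := LinearMap.BilinForm.dualSubmodule_dualSubmodule_of_basis (R := ℤ)
    Λ.Q.polarBilin Λ.nondegenerate hs b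
  rw [hb] at this
  rw [← this]
  intro y hy
  obtain ⟨m, hm⟩ := h y hy
  exact Submodule.mem_one.mpr ⟨m, by simpa [pair] using! hm.symm⟩

instance : Finite Λ.Disc := by
  obtain ⟨n, b, hb⟩ := Λ.exists_basis
  have hfg : Λ.dual.FG := by
    rw [dual, ← hb, LinearMap.BilinForm.dualSubmodule_span_of_basis Λ.Q.polarBilin Λ.nondegenerate b]
    exact Submodule.fg_span (Set.finite_range _)
  have : Module.Finite ℤ Λ.dual := Module.Finite.iff_fg.mpr hfg
  have key : ∀ x : V, ∃ m : ℤ, m ≠ 0 ∧ m • x ∈ Λ.L := fun x => by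
    have hx : x ∈ Submodule.span ℚ (Λ.L : Set V) := by rw [Λ.span_eq_top]; trivial
    induction hx using Submodule.span_induction with
    | mem x hx => exact ⟨1, one_ne_zero, by simpa using hx⟩
    | zero => exact ⟨1, one_ne_zero, by simp⟩
    | add x y _ _ hx hy =>
      obtain ⟨m, hm, hmx⟩ := hx
      obtain ⟨l, hl, hly⟩ := hy
      refine ⟨m * l, mul_ne_zero hm hl, ?_⟩
      rw [smul_add]
      refine add_mem ?_ ?_
      · rw [mul_comm, mul_smul]; exact Λ.L.smul_mem l hmx
      · rw [mul_smul]; exact Λ.L.smul_mem m hly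
    | smul a x _ hx =>
      obtain ⟨m, hm, hmx⟩ := hx
      refine ⟨m * a.den, mul_ne_zero hm (by exact_mod_cast a.den_ne_zero), ?_⟩
      have : (m * (a.den : ℤ)) • a • x = a.num • m • x := by
        rw [← Int.cast_smul_eq_zsmul ℚ, ← Int.cast_smul_eq_zsmul ℚ a.num,
          ← Int.cast_smul_eq_zsmul ℚ m, smul_smul, smul_smul]
        congr 1
        push_cast
        rw [mul_assoc, mul_comm (a.den : ℚ), Rat.mul_den_eq_num]
        ring
      rw [this]
      exact Λ.L.smul_mem _ hmx
  refine Module.finite_of_fg_torsion _ fun {γ} => ?_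
  induction γ using Submodule.Quotient.induction_on with
  | H x =>
    obtain ⟨m, hm, hmx⟩ := key x
    refine ⟨⟨m, mem_nonZeroDivisors_of_ne_zero hm⟩, ?_⟩
    change m • (Submodule.Quotient.mk x : Λ.Disc) = 0
    rw [← Submodule.Quotient.mk_smul, Submodule.Quotient.mk_eq_zero]
    exact hmx

instance : Fintype Λ.Disc := Fintype.ofFinite _

instance : DecidableEq Λ.Disc := Classical.decEq _

/-- A representative in `L'` of a class in `L'/L`. -/
def rep (γ : Λ.Disc) : V := (Quotient.out γ : Λ.dual)

theorem rep_mem (γ : Λ.Disc) : Λ.rep γ ∈ Λ.dual := (Quotient.out γ : Λ.dual).2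

theorem mk_rep (γ : Λ.Disc) : (Submodule.Quotient.mk ⟨Λ.rep γ, Λ.rep_mem γ⟩ : Λ.Disc) = γ :=
  Quotient.out_eq γ

theorem rep_sub_mem (x : Λ.dual) :
    Λ.rep (Submodule.Quotient.mk x) - x ∈ Λ.L := by
  have h := Λ.mk_rep (Submodule.Quotient.mk x)
  rw [Submodule.Quotient.eq] at h
  exact h

/-- `Q(γ)` for `γ ∈ L'/L`, computed on a representative; it matters only modulo `ℤ`, where it
does not depend on the representative (`q_mk`). -/
def q (γ : Λ.Disc) : ℚ := Λ.Q (Λ.rep γ)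

theorem q_mk (x : Λ.dual) : ∃ n : ℤ, Λ.q (Submodule.Quotient.mk x) = Λ.Q x + n := by
  have h := Λ.rep_sub_mem x
  obtain ⟨a, ha⟩ := Λ.even _ h
  obtain ⟨b, hb⟩ := Λ.mem_dual.mp x.2 _ h
  refine ⟨a + b, ?_⟩
  have := QuadraticMap.map_add Λ.Q (x : V) (Λ.rep (Submodule.Quotient.mk x) - x)
  rw [add_sub_cancel, ha] at this
  rw [pair] at hb
  rw [q, this, hb]
  push_cast
  ring

/-- `e((γ, δ))` for `γ, δ ∈ L'/L`; it does not depend on representatives (`ePair_mk`). -/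
def ePair (γ δ : Λ.Disc) : ℂ := expUnit (Λ.pair (Λ.rep γ) (Λ.rep δ))

theorem expUnit_pair_congr {x x' y : V} (hy : y ∈ Λ.dual) (h : x - x' ∈ Λ.L) :
    expUnit (Λ.pair x y) = expUnit (Λ.pair x' y) := by
  obtain ⟨n, hn⟩ := Λ.mem_dual.mp hy _ h
  rw [← sub_add_cancel x x', pair_add_left, expUnit_add, Λ.pair_comm (x - x'),
    (expUnit_eq_one_iff _).mpr ⟨n, hn⟩, one_mul]

theorem ePair_mk (x y : Λ.dual) :
    Λ.ePair (Submodule.Quotient.mk x) (Submodule.Quotient.mk y) = expUnit (Λ.pair x y) := by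
  rw [ePair, Λ.expUnit_pair_congr (Λ.rep_mem _) (Λ.rep_sub_mem x), Λ.pair_comm,
    Λ.expUnit_pair_congr x.2 (Λ.rep_sub_mem y), Λ.pair_comm]

theorem ePair_comm (γ δ : Λ.Disc) : Λ.ePair γ δ = Λ.ePair δ γ := by
  rw [ePair, ePair, pair_comm]

theorem ePair_add_right (γ δ ε : Λ.Disc) :
    Λ.ePair γ (δ + ε) = Λ.ePair γ δ * Λ.ePair γ ε := by
  induction γ using Submodule.Quotient.induction_on with | H x =>
  induction δ using Submodule.Quotient.induction_on with | H y =>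
  induction ε using Submodule.Quotient.induction_on with | H z =>
  rw [← Submodule.Quotient.mk_add, ePair_mk, ePair_mk, ePair_mk, Submodule.coe_add,
    pair_add_right, expUnit_add]

theorem ePair_mul_star (γ δ : Λ.Disc) : Λ.ePair γ δ * star (Λ.ePair γ δ) = 1 :=
  expUnit_mul_star _

theorem sum_ePair (γ γ' : Λ.Disc) :
    ∑ δ, star (Λ.ePair γ δ) * Λ.ePair γ' δ = if γ = γ' then (Fintype.card Λ.Disc : ℂ) else 0 := by
  split_ifs with h
  · subst h
    rw [Finset.sum_congr rfl fun δ _ => (mul_comm _ _).trans (Λ.ePair_mul_star γ δ)]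
    simp
  · let F : Λ.Disc → ℂ := fun δ => star (Λ.ePair γ δ) * Λ.ePair γ' δ
    have hF : ∀ δ ε, F (δ + ε) = F δ * F ε := fun δ ε => by
      simp only [F, ePair_add_right, star_mul']; ring
    obtain ⟨δ, hδ⟩ : ∃ δ, F δ ≠ 1 := by
      by_contra! hall
      apply h
      induction γ using Submodule.Quotient.induction_on with | H x =>
      induction γ' using Submodule.Quotient.induction_on with | H x' =>
      rw [eq_comm, Submodule.Quotient.eq]
      change (x' : V) - x ∈ Λ.L
      refine Λ.mem_of_pair_dual fun y hy => ?_
      have := hall (Submodule.Quotient.mk ⟨y, hy⟩)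
      simp only [F, ePair_mk] at this
      rw [← expUnit_neg, ← expUnit_add, expUnit_eq_one_iff] at this
      obtain ⟨n, hn⟩ := this
      refine ⟨n, ?_⟩
      rw [← hn]
      simp [pair, sub_eq_add_neg, QuadraticMap.polar_add_left, QuadraticMap.polar_neg_left]
      ring
    have hsum : F δ * ∑ ε, F ε = ∑ ε, F ε := by
      rw [Finset.mul_sum, ← Equiv.sum_comp (Equiv.addLeft δ) F]
      exact Finset.sum_congr rfl fun ε _ => (hF δ ε).symm
    have : (F δ - 1) * ∑ ε, F ε = 0 := by rw [sub_mul, hsum, one_mul, sub_self]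
    exact (mul_eq_zero.mp this).resolve_left (sub_ne_zero.mpr hδ)

/-- `ρ_L(T)`: the diagonal matrix `𝔢_γ ↦ e(Q(γ)) 𝔢_γ`. -/
def weilT : Matrix.unitaryGroup Λ.Disc ℂ :=
  ⟨Matrix.diagonal fun γ => expUnit (Λ.q γ), by
    rw [Matrix.mem_unitaryGroup_iff, Matrix.star_eq_conjTranspose, Matrix.diagonal_conjTranspose,
      Matrix.diagonal_mul_diagonal, ← Matrix.diagonal_one]
    exact congrArg _ (funext fun γ => expUnit_mul_star _)⟩

/-- The matrix of `ρ_L(S)`: its column `γ` is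
`ρ_L(S) 𝔢_γ = e((b⁻ - b⁺)/8) / √|L'/L| · ∑_δ e(-(γ, δ)) 𝔢_δ`. -/
def weilSMatrix : Matrix Λ.Disc Λ.Disc ℂ := Matrix.of fun δ γ =>
  expUnit (((sigNeg Λ.Q : ℚ) - (sigPos Λ.Q : ℚ)) / 8) / (Real.sqrt (Fintype.card Λ.Disc) : ℂ)
    * expUnit (-Λ.pair (Λ.rep γ) (Λ.rep δ))

theorem weilSMatrix_mem : Λ.weilSMatrix ∈ Matrix.unitaryGroup Λ.Disc ℂ := by
  rw [Matrix.mem_unitaryGroup_iff, Matrix.star_eq_conjTranspose]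
  have hN : ((Real.sqrt (Fintype.card Λ.Disc) : ℝ) : ℂ) * (Real.sqrt (Fintype.card Λ.Disc) : ℝ)
      = Fintype.card Λ.Disc := by
    rw [← Complex.ofReal_mul, Real.mul_self_sqrt (Nat.cast_nonneg _)]; simp
  have h0 : (Fintype.card Λ.Disc : ℂ) ≠ 0 := Nat.cast_ne_zero.mpr Fintype.card_ne_zero
  set c := expUnit (((sigNeg Λ.Q : ℚ) - (sigPos Λ.Q : ℚ)) / 8) with hc
  set r : ℂ := ((Real.sqrt (Fintype.card Λ.Disc) : ℝ) : ℂ) with hr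
  have hcc : c * star c = 1 := expUnit_mul_star _
  have hrr : star r = r := Complex.conj_ofReal _
  have hE : ∀ a b, expUnit (-Λ.pair (Λ.rep a) (Λ.rep b)) = star (Λ.ePair a b) :=
    fun _ _ => expUnit_neg _
  ext δ δ'
  rw [Matrix.mul_apply]
  have : ∀ γ, Λ.weilSMatrix δ γ * (Λ.weilSMatrix.conjTranspose) γ δ' =
      (Fintype.card Λ.Disc : ℂ)⁻¹ * (star (Λ.ePair δ γ) * Λ.ePair δ' γ) := fun γ => by
    simp only [weilSMatrix, Matrix.conjTranspose_apply, Matrix.of_apply, ← hc, ← hr, star_mul',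
      hE,
      star_div₀, star_star, hrr, Λ.ePair_comm γ]
    rw [← hN]
    calc _ = (c * star c) * (r * r)⁻¹ * (star (Λ.ePair δ γ) * Λ.ePair δ' γ) := by
          rw [mul_inv]; ring
      _ = _ := by rw [hcc, one_mul]
  rw [Finset.sum_congr rfl fun γ _ => this γ, ← Finset.mul_sum, sum_ePair, Matrix.one_apply]
  split_ifs
  · exact inv_mul_cancel₀ h0
  · simp

/-- `ρ_L(S)` as a unitary matrix. -/
def weilS : Matrix.unitaryGroup Λ.Disc ℂ := ⟨Λ.weilSMatrix, Λ.weilSMatrix_mem⟩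

/-- The graph of the Weil representation `ρ_L : Mp₂(ℤ) → U(ℂ[L'/L])`. Since `S` and `T` generate
`Mp₂(ℤ)`, the graph of the homomorphism with the given values `ρ_L(T)` and `ρ_L(S)` is the subgroup
of the product generated by `(T, ρ_L(T))` and `(S, ρ_L(S))`. -/
def weilGraph : Subgroup (Mp2Z × Matrix.unitaryGroup Λ.Disc ℂ) :=
  Subgroup.closure {(Mp2Z.T, Λ.weilT), (Mp2Z.S, Λ.weilS)}

theorem exists_mem_weilGraph (g : Mp2Z) : ∃ U, (g, U) ∈ Λ.weilGraph := by
  have h : Λ.weilGraph.map (MonoidHom.fst _ _) = ⊤ := by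
    rw [weilGraph, MonoidHom.map_closure, Set.image_pair, Set.pair_comm]
    exact Mp2Z.closure_S_T
  obtain ⟨⟨g', U⟩, hU, rfl⟩ : g ∈ Λ.weilGraph.map (MonoidHom.fst _ _) := by rw [h]; trivial
  exact ⟨U, hU⟩

/-- `A = ρ_L(g)`. -/
def WeilRel (g : Mp2Z) (A : Matrix Λ.Disc Λ.Disc ℂ) : Prop :=
  ∃ U, (g, U) ∈ Λ.weilGraph ∧ A = (U : Matrix Λ.Disc Λ.Disc ℂ)

/-- `A = ρ̄_L(g)` for the dual representation `ρ̄_L(g) = ρ_L(g⁻¹)ᵗ`, written in the basis dual to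
`(𝔢_γ)`, which is again denoted by `(𝔢_γ)`. As `ρ_L` is unitary, this is the entrywise complex
conjugate of `ρ_L(g)`. -/
def DualWeilRel (g : Mp2Z) (A : Matrix Λ.Disc Λ.Disc ℂ) : Prop :=
  ∃ U, (g, U) ∈ Λ.weilGraph ∧ A = ((U⁻¹ : Matrix.unitaryGroup Λ.Disc ℂ) :
    Matrix Λ.Disc Λ.Disc ℂ).transpose

end EvenLattice

/-! ### Vector valued forms

A function `f = ∑_γ f_γ 𝔢_γ : ℍ → ℂ[L'/L]` is given by its components, `f τ γ = f_γ(τ)`.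
The type of a form is given by a relation `R g A` (meaning `A = ρ(g)`), together with
`q : L'/L → ℚ` such that the exponents of the component `γ` lie in `ℤ + q(γ)`. -/

/-- `∂F/∂x`. -/
def partialX (F : ℍ → ℂ) : ℍ → ℂ := fun τ => fderiv ℝ (F ∘ ofComplex) (τ : ℂ) 1

/-- `∂F/∂y`. -/
def partialY (F : ℍ → ℂ) : ℍ → ℂ := fun τ => fderiv ℝ (F ∘ ofComplex) (τ : ℂ) Complex.I

/-- `Δ_k = -y² (∂²/∂x² + ∂²/∂y²) + i k y (∂/∂x + i ∂/∂y)`. -/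
def hypLaplacian (k : ℤ) (F : ℍ → ℂ) : ℍ → ℂ := fun τ =>
  -(τ.im : ℂ) ^ 2 * (partialX (partialX F) τ + partialY (partialY F) τ)
    + Complex.I * k * τ.im * (partialX F τ + Complex.I * partialY F τ)

/-- `e(nτ) = exp(2πinτ)`. -/
def expTau (n : ℚ) (τ : ℍ) : ℂ := Complex.exp (2 * Real.pi * Complex.I * (n : ℂ) * (τ : ℂ))

/-- The incomplete Gamma function `Γ(a, x) = ∫_x^∞ e^{-t} t^{a-1} dt`. -/
def incGamma (a x : ℝ) : ℝ := ∫ t in Set.Ioi x, Real.exp (-t) * t ^ (a - 1)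

section VectorValued

variable {D : Type*} [Fintype D]

/-- `D = (1 / 2πi) d/dτ`, where `d/dτ = (∂/∂x - i ∂/∂y) / 2`, applied to each component. -/
def opD (f : ℍ → D → ℂ) : ℍ → D → ℂ := fun τ γ =>
  1 / (2 * Real.pi * Complex.I) *
    ((partialX (fun z => f z γ) τ - Complex.I * partialY (fun z => f z γ) τ) / 2)

/-- `f(Mτ) = φ(τ)^{2k} ρ(M, φ) f(τ)` for all `(M, φ) ∈ Mp₂(ℤ)`. -/
def IsModular (R : Mp2Z → Matrix D D ℂ → Prop) (k : ℤ) (f : ℍ → D → ℂ) : Prop :=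
  ∀ g A, R g A → ∀ τ : ℍ, f (g.mat • τ) = g.phi τ ^ (2 * k) • A.mulVec (f τ)

/-- `c(γ, n)` is supported on `n ∈ ℤ + q(γ)`. -/
def SuppCoset (q : D → ℚ) (c : D → ℚ → ℂ) : Prop :=
  ∀ γ n, c γ n ≠ 0 → ∃ j : ℤ, n = j + q γ

/-- `c(γ, n)` is supported on `n ≫ -∞`. -/
def SuppBddBelow (c : D → ℚ → ℂ) : Prop :=
  ∃ N : ℚ, ∀ γ n, c γ n ≠ 0 → N ≤ n

/-- `f(τ) = ∑_γ ∑_{n ∈ ℤ + q(γ), n ≫ -∞} c(γ, n) e(nτ) 𝔢_γ`. -/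
structure HasFourierExpansion (q : D → ℚ) (f : ℍ → D → ℂ) (c : D → ℚ → ℂ) : Prop where
  suppCoset : SuppCoset q c
  bddBelow : SuppBddBelow c
  hasSum : ∀ τ γ, HasSum (fun n : ℚ => c γ n * expTau n τ) (f τ γ)

/-- `f = f⁺ + f⁻` with
`f⁺(τ) = ∑_γ ∑_{n ∈ ℤ + q(γ), n ≫ -∞} c⁺(γ, n) e(nτ) 𝔢_γ` and
`f⁻(τ) = ∑_γ ∑_{n ∈ ℤ + q(γ), n < 0} c⁻(γ, n) Γ(1 - k, 4π|n|y) e(nτ) 𝔢_γ`. -/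
structure HasMaassExpansion (q : D → ℚ) (k : ℤ) (f : ℍ → D → ℂ) (cp cm : D → ℚ → ℂ) :
    Prop where
  suppCoset_pos : SuppCoset q cp
  bddBelow_pos : SuppBddBelow cp
  suppCoset_neg : SuppCoset q cm
  neg_of_ne_zero : ∀ γ n, cm γ n ≠ 0 → n < 0
  expansion : ∀ τ γ, ∃ a b : ℂ,
    HasSum (fun n : ℚ => cp γ n * expTau n τ) a ∧
    HasSum (fun n : ℚ =>
      cm γ n * (incGamma ((1 - k : ℤ) : ℝ) (4 * Real.pi * |(n : ℝ)| * τ.im) : ℂ) * expTau n τ) b ∧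
    f τ γ = a + b

/-- Weakly holomorphic modular forms of weight `k` and given type. -/
structure IsWeaklyHolomorphic (R : Mp2Z → Matrix D D ℂ → Prop) (q : D → ℚ) (k : ℤ)
    (f : ℍ → D → ℂ) : Prop where
  holo : ∀ γ, MDifferentiable 𝓘(ℂ) 𝓘(ℂ) (fun τ => f τ γ)
  modular : IsModular R k f
  meromorphic : ∃ c, HasFourierExpansion q f c

/-- Harmonic weak Maass forms of weight `k` and given type. In `growth`, `P` collects the
coefficients of the Fourier polynomial `P_f`, and the `O`-term is as `y → ∞`, uniformly in `x`. -/
structure IsHarmonicMaass (R : Mp2Z → Matrix D D ℂ → Prop) (q : D → ℚ) (k : ℤ)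
    (f : ℍ → D → ℂ) : Prop where
  smooth : ∀ γ, ContDiffOn ℝ ∞ ((fun τ => f τ γ) ∘ ofComplex) {z : ℂ | 0 < z.im}
  modular : IsModular R k f
  harmonic : ∀ γ τ, hypLaplacian k (fun z => f z γ) τ = 0
  growth : ∃ P : D → ℚ →₀ ℂ,
    (∀ γ n, P γ n ≠ 0 → (∃ j : ℤ, n = j + q γ) ∧ n ≤ 0) ∧
    ∃ ε : ℝ, 0 < ε ∧ ∀ γ,
      (fun τ : ℍ => f τ γ - (P γ).sum fun n a => a * expTau n τ)
        =O[atImInfty] fun τ : ℍ => Real.exp (-ε * τ.im)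

end VectorValued

namespace EvenLattice

variable {V : Type*} [AddCommGroup V] [Module ℚ V] (Λ : EvenLattice V)

/-- `H_{k, ρ_L}`. -/
def H (k : ℤ) : Set (ℍ → Λ.Disc → ℂ) := {f | IsHarmonicMaass Λ.WeilRel Λ.q k f}

/-- `H_{k, ρ̄_L}`. -/
def HDual (k : ℤ) : Set (ℍ → Λ.Disc → ℂ) :=
  {f | IsHarmonicMaass Λ.DualWeilRel (fun γ => -Λ.q γ) k f}

/-- `M^!_{k, ρ̄_L}`. -/
def MDual (k : ℤ) : Set (ℍ → Λ.Disc → ℂ) :=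
  {f | IsWeaklyHolomorphic Λ.DualWeilRel (fun γ => -Λ.q γ) k f}

end EvenLattice

end

/-!
Write `k = -n` and `g = D^{n+1} h`, and let `R_κ = ∂_τ + κ / (2iy)`. Bol's identity says that
`∂_τ^{n+1}` is the iterated raising operator `R_n R_{n-2} ⋯ R_{-n}`. Hence
`G = R_{n-2} ⋯ R_{-n} h` transforms with weight `n`, and `R_n G = ∂_τ^{n+1} h` is holomorphic of
weight `n + 2`. On the other side, harmonicity of `f` reads
`∂_τ ∂_τ̄ f = (n / (2iy)) ∂_τ̄ f`. Together these make the 1-form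
`∑_γ (f_γ R_n G_γ dτ + ∂_τ̄ f_γ G_γ dτ̄)` closed, and it is invariant under `SL₂(ℤ)` because `f` and
`h` transform in dual ways. The periods of a primitive form a homomorphism `SL₂(ℤ) → ℂ`, which is
trivial since the abelianization of `SL₂(ℤ)` is finite. So the primitive is 1-periodic and the
integral of the form over a horizontal segment of length one vanishes.

By Parseval this integral is a sum over frequencies `ν` of products of Fourier coefficients at `ν`
and `-ν`. Each summand does not depend on the height `y`, again by closedness. As `y → ∞` it tends
to `c_f^+(ν) c_g(-ν)` up to a constant, since the incomplete Gamma terms of `f` and the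
coefficients of `∂_τ̄ f` decay.
-/

noncomputable section

open Filter Topology
open scoped ComplexConjugate

/-! ### Wirtinger calculus on the upper half plane -/

theorem comp_ofComplex_eventuallyEq (f : ℂ → ℂ) (τ : ℍ) :
    (fun z : ℍ => f z) ∘ ofComplex =ᶠ[𝓝 (τ : ℂ)] f := by
  filter_upwards [isOpen_upperHalfPlaneSet.mem_nhds τ.im_pos] with z hz
  simp [ofComplex_apply_of_im_pos hz]

/-- Real smoothness of a function on the upper half plane. -/
def SmoothOnH (F : ℍ → ℂ) : Prop := ContDiffOn ℝ ∞ (F ∘ ofComplex) {z : ℂ | 0 < z.im}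

/-- The real-linear map `v ↦ a v + b v̄`: the differential of a function with Wirtinger
derivatives `a` and `b`. -/
def wirtinger (a b : ℂ) : ℂ →L[ℝ] ℂ :=
  a • ContinuousLinearMap.id ℝ ℂ + b • (Complex.conjCLE : ℂ →L[ℝ] ℂ)

/-- `F` is real differentiable at `τ` with `∂F/∂τ = a` and `∂F/∂τ̄ = b`. -/
def HasWirtingerAt (F : ℍ → ℂ) (a b : ℂ) (τ : ℍ) : Prop :=
  HasFDerivAt (F ∘ ofComplex) (wirtinger a b) (τ : ℂ)

/-- The Wirtinger derivative `∂F/∂τ`. -/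
def dTau (F : ℍ → ℂ) : ℍ → ℂ := fun τ => (partialX F τ - Complex.I * partialY F τ) / 2

/-- The Wirtinger derivative `∂F/∂τ̄`. -/
def dTauBar (F : ℍ → ℂ) : ℍ → ℂ := fun τ => (partialX F τ + Complex.I * partialY F τ) / 2

@[simp] theorem wirtinger_apply (a b v : ℂ) : wirtinger a b v = a * v + b * conj v := by
  simp [wirtinger]

theorem clm_eq_wirtinger (A : ℂ →L[ℝ] ℂ) :
    A = wirtinger ((A 1 - Complex.I * A Complex.I) / 2) ((A 1 + Complex.I * A Complex.I) / 2) := by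
  refine ContinuousLinearMap.coe_injective (Complex.basisOneI.ext fun i => ?_)
  fin_cases i
  · simp only [Fin.zero_eta, Complex.coe_basisOneI, Matrix.cons_val_zero,
      ContinuousLinearMap.coe_coe, wirtinger_apply, map_one]
    ring
  · simp only [Fin.mk_one, Complex.coe_basisOneI, Matrix.cons_val_one, Matrix.cons_val_fin_one,
      ContinuousLinearMap.coe_coe, wirtinger_apply, Complex.conj_I]
    linear_combination A Complex.I * Complex.I_sq

theorem partialX_eq (F : ℍ → ℂ) (τ : ℍ) : partialX F τ = dTau F τ + dTauBar F τ := by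
  simp only [dTau, dTauBar]; ring

theorem partialY_eq (F : ℍ → ℂ) (τ : ℍ) :
    partialY F τ = Complex.I * (dTau F τ - dTauBar F τ) := by
  simp only [dTau, dTauBar]
  linear_combination partialY F τ * Complex.I_sq

theorem hasWirtingerAt_of_hasFDerivAt {f : ℂ → ℂ} {a b : ℂ} {τ : ℍ}
    (h : HasFDerivAt f (wirtinger a b) (τ : ℂ)) : HasWirtingerAt (fun z : ℍ => f z) a b τ :=
  HasFDerivAt.congr_of_eventuallyEq h (comp_ofComplex_eventuallyEq f τ)

theorem hasWirtingerAt_of_hasDerivAt {f : ℂ → ℂ} {f' : ℂ} {τ : ℍ} (h : HasDerivAt f f' (τ : ℂ)) :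
    HasWirtingerAt (fun z : ℍ => f z) f' 0 τ :=
  hasWirtingerAt_of_hasFDerivAt <| (h.hasFDerivAt.restrictScalars ℝ).congr_fderiv <| by
    ext v; simp [mul_comm]

namespace HasWirtingerAt

variable {F G : ℍ → ℂ} {a b a' b' : ℂ} {τ : ℍ}

theorem dTau_eq (h : HasWirtingerAt F a b τ) : dTau F τ = a := by
  simp only [dTau, partialX, partialY, HasFDerivAt.fderiv h, wirtinger_apply, map_one,
    Complex.conj_I]
  linear_combination (-a / 2 + b / 2) * Complex.I_sq

theorem dTauBar_eq (h : HasWirtingerAt F a b τ) : dTauBar F τ = b := by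
  simp only [dTauBar, partialX, partialY, HasFDerivAt.fderiv h, wirtinger_apply, map_one,
    Complex.conj_I]
  linear_combination (a / 2 - b / 2) * Complex.I_sq

theorem congr_coeff (h : HasWirtingerAt F a b τ) (ha : a = a') (hb : b = b') :
    HasWirtingerAt F a' b' τ := by rwa [← ha, ← hb]

theorem add (h : HasWirtingerAt F a b τ) (h' : HasWirtingerAt G a' b' τ) :
    HasWirtingerAt (fun z => F z + G z) (a + a') (b + b') τ := by
  refine (HasFDerivAt.add h h').congr_fderiv ?_
  ext v
  simp only [add_apply, wirtinger_apply]; ring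

theorem const_mul (c : ℂ) (h : HasWirtingerAt F a b τ) :
    HasWirtingerAt (fun z => c * F z) (c * a) (c * b) τ := by
  refine (HasFDerivAt.const_mul h c).congr_fderiv ?_
  ext v
  simp only [smul_apply, wirtinger_apply, smul_eq_mul]; ring

theorem mul (h : HasWirtingerAt F a b τ) (h' : HasWirtingerAt G a' b' τ) :
    HasWirtingerAt (fun z => F z * G z) (a * G τ + F τ * a') (b * G τ + F τ * b') τ := by
  refine (HasFDerivAt.mul h h').congr_fderiv ?_
  ext v
  simp only [Function.comp_apply, ofComplex_apply, add_apply, smul_apply, wirtinger_apply,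
    smul_eq_mul]
  ring

theorem pow (h : HasWirtingerAt F a b τ) (j : ℕ) :
    HasWirtingerAt (fun z => F z ^ j) (j * F τ ^ (j - 1) * a) (j * F τ ^ (j - 1) * b) τ := by
  refine (HasFDerivAt.pow h j).congr_fderiv ?_
  ext v
  simp only [Function.comp_apply, ofComplex_apply, nsmul_eq_mul, smul_apply, wirtinger_apply,
    smul_eq_mul]
  ring

theorem inv (h : HasWirtingerAt F a b τ) (hF : F τ ≠ 0) :
    HasWirtingerAt (fun z => (F z)⁻¹) (-(F τ)⁻¹ ^ 2 * a) (-(F τ)⁻¹ ^ 2 * b) τ := by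
  have hF' : (F ∘ ofComplex) τ ≠ 0 := by simpa using hF
  refine (((hasDerivAt_inv hF').hasFDerivAt.restrictScalars ℝ).comp (τ : ℂ) h).congr_fderiv ?_
  ext v
  simp only [Function.comp_apply, ofComplex_apply, ContinuousLinearMap.comp_apply,
    wirtinger_apply, ContinuousLinearMap.coe_restrictScalars',
    ContinuousLinearMap.toSpanSingleton_apply, smul_eq_mul, mul_neg, inv_pow, neg_mul]
  ring

theorem sum {ι : Type*} {s : Finset ι} {F : ι → ℍ → ℂ} {a b : ι → ℂ}
    (h : ∀ i ∈ s, HasWirtingerAt (F i) (a i) (b i) τ) :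
    HasWirtingerAt (fun z => ∑ i ∈ s, F i z) (∑ i ∈ s, a i) (∑ i ∈ s, b i) τ := by
  refine HasFDerivAt.congr_fderiv (f' := ∑ i ∈ s, wirtinger (a i) (b i))
    (HasFDerivAt.fun_sum h) ?_
  ext v
  simp [Finset.sum_add_distrib, Finset.sum_mul]

end HasWirtingerAt

namespace SmoothOnH

variable {F G : ℍ → ℂ}

theorem hasWirtingerAt (h : SmoothOnH F) (τ : ℍ) :
    HasWirtingerAt F (dTau F τ) (dTauBar F τ) τ := by
  have hderiv := ((h.contDiffAt (isOpen_upperHalfPlaneSet.mem_nhds τ.im_pos)).differentiableAt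
    (by simp)).hasFDerivAt
  rwa [clm_eq_wirtinger (fderiv ℝ (F ∘ ofComplex) τ)] at hderiv

theorem continuousOn (h : SmoothOnH F) : ContinuousOn (F ∘ ofComplex) {z : ℂ | 0 < z.im} :=
  ContDiffOn.continuousOn h

theorem of_contDiffOn {f : ℂ → ℂ} (h : ContDiffOn ℝ ∞ f {z : ℂ | 0 < z.im}) :
    SmoothOnH fun z : ℍ => f z :=
  h.congr fun z hz => by simp [ofComplex_apply_of_im_pos hz]

theorem const (c : ℂ) : SmoothOnH fun _ => c := contDiffOn_const

theorem add (h : SmoothOnH F) (h' : SmoothOnH G) : SmoothOnH fun z => F z + G z :=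
  ContDiffOn.add h h'

theorem mul (h : SmoothOnH F) (h' : SmoothOnH G) : SmoothOnH fun z => F z * G z :=
  ContDiffOn.mul h h'

theorem const_mul (c : ℂ) (h : SmoothOnH F) : SmoothOnH fun z => c * F z := (const c).mul h

theorem pow (h : SmoothOnH F) (j : ℕ) : SmoothOnH fun z => F z ^ j := ContDiffOn.pow h j

theorem sum {ι : Type*} {s : Finset ι} {F : ι → ℍ → ℂ} (h : ∀ i ∈ s, SmoothOnH (F i)) :
    SmoothOnH fun z => ∑ i ∈ s, F i z :=
  ContDiffOn.sum h

theorem contDiffOn_fderiv (h : SmoothOnH F) :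
    ContDiffOn ℝ ∞ (fderiv ℝ (F ∘ ofComplex)) {z : ℂ | 0 < z.im} :=
  ContDiffOn.fderiv_of_isOpen h isOpen_upperHalfPlaneSet (by simp)

theorem fderiv_apply (h : SmoothOnH F) (v : ℂ) :
    SmoothOnH fun τ : ℍ => fderiv ℝ (F ∘ ofComplex) (τ : ℂ) v :=
  of_contDiffOn (h.contDiffOn_fderiv.clm_apply contDiffOn_const)

theorem partialX (h : SmoothOnH F) : SmoothOnH (partialX F) := h.fderiv_apply 1

theorem partialY (h : SmoothOnH F) : SmoothOnH (partialY F) := h.fderiv_apply Complex.I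

theorem dTau (h : SmoothOnH F) : SmoothOnH (dTau F) := by
  convert (h.partialX.add (h.partialY.const_mul (-Complex.I))).const_mul (1 / 2) using 1
  funext z; simp only [_root_.dTau]; ring

theorem dTauBar (h : SmoothOnH F) : SmoothOnH (dTauBar F) := by
  convert (h.partialX.add (h.partialY.const_mul Complex.I)).const_mul (1 / 2) using 1
  funext z; simp only [_root_.dTauBar]; ring

theorem iterate_dTau (h : SmoothOnH F) (n : ℕ) : SmoothOnH (_root_.dTau^[n] F) := by
  induction n with
  | zero => exact h
  | succ n ih => rw [Function.iterate_succ_apply']; exact ih.dTau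

theorem fderiv_fderiv_apply (h : SmoothOnH F) (v w : ℂ) (τ : ℍ) :
    fderiv ℝ ((fun τ : ℍ => fderiv ℝ (F ∘ ofComplex) (τ : ℂ) v) ∘ ofComplex) (τ : ℂ) w =
      fderiv ℝ (fderiv ℝ (F ∘ ofComplex)) (τ : ℂ) w v := by
  have hdiff : DifferentiableAt ℝ (fderiv ℝ (F ∘ ofComplex)) (τ : ℂ) :=
    (h.contDiffOn_fderiv.contDiffAt
      (isOpen_upperHalfPlaneSet.mem_nhds τ.im_pos)).differentiableAt (by simp)
  rw [(comp_ofComplex_eventuallyEq (fun z => fderiv ℝ (F ∘ ofComplex) z v) τ).fderiv_eq,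
    (hdiff.hasFDerivAt.clm_apply (hasFDerivAt_const v _)).fderiv]
  simp

theorem partialX_partialY (h : SmoothOnH F) (τ : ℍ) :
    _root_.partialX (_root_.partialY F) τ = _root_.partialY (_root_.partialX F) τ := by
  have hsymm : IsSymmSndFDerivAt ℝ (F ∘ ofComplex) (τ : ℂ) :=
    (h.contDiffAt (isOpen_upperHalfPlaneSet.mem_nhds τ.im_pos)).isSymmSndFDerivAt
      (by rw [minSmoothness_of_isRCLikeNormedField]; exact WithTop.coe_le_coe.2 le_top)
  exact (h.fderiv_fderiv_apply _ _ τ).trans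
    ((hsymm.eq _ _).trans (h.fderiv_fderiv_apply _ _ τ).symm)

end SmoothOnH

section WirtingerRules

variable {F G : ℍ → ℂ}

theorem dTau_mul (hF : SmoothOnH F) (hG : SmoothOnH G) (τ : ℍ) :
    dTau (fun z => F z * G z) τ = dTau F τ * G τ + F τ * dTau G τ :=
  ((hF.hasWirtingerAt τ).mul (hG.hasWirtingerAt τ)).dTau_eq

theorem dTauBar_mul (hF : SmoothOnH F) (hG : SmoothOnH G) (τ : ℍ) :
    dTauBar (fun z => F z * G z) τ = dTauBar F τ * G τ + F τ * dTauBar G τ :=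
  ((hF.hasWirtingerAt τ).mul (hG.hasWirtingerAt τ)).dTauBar_eq

theorem dTau_add (hF : SmoothOnH F) (hG : SmoothOnH G) (τ : ℍ) :
    dTau (fun z => F z + G z) τ = dTau F τ + dTau G τ :=
  ((hF.hasWirtingerAt τ).add (hG.hasWirtingerAt τ)).dTau_eq

theorem dTau_const_mul (c : ℂ) (hF : SmoothOnH F) (τ : ℍ) :
    dTau (fun z => c * F z) τ = c * dTau F τ :=
  ((hF.hasWirtingerAt τ).const_mul c).dTau_eq

theorem dTau_dTauBar (hF : SmoothOnH F) (τ : ℍ) :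
    dTau (dTauBar F) τ = (partialX (partialX F) τ + partialY (partialY F) τ) / 4 := by
  have hdef : dTauBar F = fun z => 1 / 2 * partialX F z + Complex.I / 2 * partialY F z := by
    funext z; simp only [dTauBar]; ring
  rw [hdef, (((hF.partialX.hasWirtingerAt τ).const_mul (1 / 2)).add
    ((hF.partialY.hasWirtingerAt τ).const_mul (Complex.I / 2))).dTau_eq]
  simp only [dTau]
  linear_combination Complex.I / 4 * hF.partialX_partialY τ -
    partialY (partialY F) τ / 4 * Complex.I_sq

theorem dTauBar_dTau (hF : SmoothOnH F) (τ : ℍ) :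
    dTauBar (dTau F) τ = (partialX (partialX F) τ + partialY (partialY F) τ) / 4 := by
  have hdef : dTau F = fun z => 1 / 2 * partialX F z + -Complex.I / 2 * partialY F z := by
    funext z; simp only [dTau]; ring
  rw [hdef, (((hF.partialX.hasWirtingerAt τ).const_mul (1 / 2)).add
    ((hF.partialY.hasWirtingerAt τ).const_mul (-Complex.I / 2))).dTauBar_eq]
  simp only [dTauBar]
  linear_combination -Complex.I / 4 * hF.partialX_partialY τ -
    partialY (partialY F) τ / 4 * Complex.I_sq

theorem dTauBar_iterate_dTau (hF : SmoothOnH F) (n : ℕ) :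
    dTauBar (dTau^[n] F) = dTau^[n] (dTauBar F) := by
  induction n with
  | zero => rfl
  | succ n ih =>
    have hn := hF.iterate_dTau n
    rw [Function.iterate_succ_apply', Function.iterate_succ_apply', ← ih]
    exact funext fun τ => (dTauBar_dTau hn τ).trans (dTau_dTauBar hn τ).symm

theorem mdifferentiable_of_dTauBar_eq_zero (hF : SmoothOnH F) (h : ∀ τ, dTauBar F τ = 0) :
    MDifferentiable 𝓘(ℂ) 𝓘(ℂ) F := by
  rw [mdifferentiable_iff]
  intro z hz
  have hderiv := hF.hasWirtingerAt ⟨z, hz⟩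
  rw [h, HasWirtingerAt, hasFDerivAt_iff_isLittleO] at hderiv
  refine (HasDerivAt.differentiableAt (f' := dTau F ⟨z, hz⟩) ?_).differentiableWithinAt
  rw [hasDerivAt_iff_isLittleO]
  refine hderiv.congr_left fun w => ?_
  simp [mul_comm]

end WirtingerRules

/-- `2iy`, written as `τ - τ̄`. -/
def twoIY : ℍ → ℂ := fun τ => (τ : ℂ) - conj (τ : ℂ)

/-- The function `1 / (2iy)`, through which the weight enters the raising operators. -/
def invTwoIY : ℍ → ℂ := fun τ => (twoIY τ)⁻¹

theorem twoIY_eq (τ : ℍ) : twoIY τ = 2 * Complex.I * τ.im := by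
  rw [twoIY, Complex.sub_conj, UpperHalfPlane.coe_im]
  push_cast; ring

theorem twoIY_ne_zero (τ : ℍ) : twoIY τ ≠ 0 := by
  rw [twoIY_eq]
  exact mul_ne_zero (mul_ne_zero two_ne_zero Complex.I_ne_zero)
    (Complex.ofReal_ne_zero.2 τ.im_ne_zero)

theorem twoIY_mul_invTwoIY (τ : ℍ) : twoIY τ * invTwoIY τ = 1 :=
  mul_inv_cancel₀ (twoIY_ne_zero τ)

theorem smoothOnH_twoIY : SmoothOnH twoIY :=
  SmoothOnH.of_contDiffOn (f := fun z => z - conj z)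
    (contDiff_id.sub Complex.conjCLE.contDiff).contDiffOn

theorem hasWirtingerAt_twoIY (τ : ℍ) : HasWirtingerAt twoIY 1 (-1) τ :=
  hasWirtingerAt_of_hasFDerivAt (f := fun z => z - conj z) <|
    ((hasFDerivAt_id (τ : ℂ)).sub Complex.conjCLE.hasFDerivAt).congr_fderiv <| by
      ext v
      simp only [sub_apply, ContinuousLinearMap.id_apply, ContinuousLinearEquiv.coe_coe,
        ContinuousAlgEquiv.coeCLE_apply, Complex.conjCAE_apply, wirtinger_apply, one_mul, neg_mul]
      ring

theorem smoothOnH_invTwoIY : SmoothOnH invTwoIY :=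
  ContDiffOn.inv smoothOnH_twoIY fun _ _ => twoIY_ne_zero _

theorem hasWirtingerAt_invTwoIY (τ : ℍ) :
    HasWirtingerAt invTwoIY (-invTwoIY τ ^ 2) (invTwoIY τ ^ 2) τ :=
  ((hasWirtingerAt_twoIY τ).inv (twoIY_ne_zero τ)).congr_coeff
    (by rw [invTwoIY]; ring) (by rw [invTwoIY]; ring)

theorem dTau_invTwoIY_pow (j : ℕ) (τ : ℍ) :
    dTau (fun z => invTwoIY z ^ j) τ = -(j : ℂ) * invTwoIY τ ^ (j + 1) := by
  rw [((hasWirtingerAt_invTwoIY τ).pow j).dTau_eq]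
  cases j with
  | zero => simp
  | succ j => rw [Nat.add_sub_cancel]; ring

/-! ### Harmonicity and Bol's identity -/

/-- Smooth solutions of the Laplace equation `Δ_{-n} F = 0` in weight `-n`, with the equation
written in Wirtinger derivatives. -/
structure IsHarmonicNeg (n : ℕ) (F : ℍ → ℂ) : Prop where
  smooth : SmoothOnH F
  dTau_dTauBar : ∀ τ, dTau (dTauBar F) τ = n * invTwoIY τ * dTauBar F τ

theorem hypLaplacian_eq {F : ℍ → ℂ} (hF : SmoothOnH F) (k : ℤ) (τ : ℍ) :
    hypLaplacian k F τ =
      twoIY τ ^ 2 * dTau (dTauBar F) τ + k * twoIY τ * dTauBar F τ := by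
  rw [hypLaplacian, dTau_dTauBar hF, twoIY_eq, dTauBar]
  linear_combination -(τ.im : ℂ) ^ 2 *
    (partialX (partialX F) τ + partialY (partialY F) τ) * Complex.I_sq

theorem isHarmonicNeg_of_hypLaplacian_eq_zero {n : ℕ} {F : ℍ → ℂ} (hF : SmoothOnH F)
    (h : ∀ τ, hypLaplacian (-n) F τ = 0) : IsHarmonicNeg n F where
  smooth := hF
  dTau_dTauBar τ := by
    have hτ := h τ
    rw [hypLaplacian_eq hF] at hτ
    push_cast at hτ
    apply mul_left_cancel₀ (pow_ne_zero 2 (twoIY_ne_zero τ))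
    linear_combination hτ - n * twoIY τ * dTauBar F τ * twoIY_mul_invTwoIY τ

theorem iterate_dTau_of_dTau_eq {n : ℕ} {u : ℍ → ℂ} (hu : SmoothOnH u)
    (h : ∀ τ, dTau u τ = n * invTwoIY τ * u τ) (j : ℕ) :
    dTau^[j] u = fun τ => (n.descFactorial j : ℂ) * (invTwoIY τ ^ j * u τ) := by
  induction j with
  | zero => funext τ; simp
  | succ j ih =>
    have hpow : SmoothOnH fun z => invTwoIY z ^ j := smoothOnH_invTwoIY.pow j
    funext τ
    rw [Function.iterate_succ_apply', ih, dTau_const_mul _ (hpow.mul hu), dTau_mul hpow hu, h,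
      dTau_invTwoIY_pow, Nat.descFactorial_succ]
    rcases le_or_gt j n with hj | hj
    · push_cast [Nat.cast_sub hj]; ring
    · rw [Nat.descFactorial_of_lt hj]; simp

theorem IsHarmonicNeg.dTauBar_iterate_dTau_eq_zero {n : ℕ} {F : ℍ → ℂ} (h : IsHarmonicNeg n F)
    (τ : ℍ) : dTauBar (dTau^[n + 1] F) τ = 0 := by
  rw [dTauBar_iterate_dTau h.smooth, iterate_dTau_of_dTau_eq h.smooth.dTauBar h.dTau_dTauBar,
    Nat.descFactorial_of_lt (Nat.lt_succ_self n)]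
  simp

/-- The raising operator `R_κ = ∂/∂τ + κ / (2iy)`. -/
def raise (κ : ℂ) (F : ℍ → ℂ) : ℍ → ℂ := fun τ => dTau F τ + κ * invTwoIY τ * F τ

/-- The iterated raising operator `R_{κ + 2n - 2} ⋯ R_{κ + 2} R_κ`. -/
def raiseIter (κ : ℂ) : ℕ → (ℍ → ℂ) → ℍ → ℂ
  | 0, F => F
  | n + 1, F => raise (κ + 2 * n) (raiseIter κ n F)

theorem SmoothOnH.raise {F : ℍ → ℂ} (hF : SmoothOnH F) (κ : ℂ) : SmoothOnH (raise κ F) :=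
  hF.dTau.add ((smoothOnH_invTwoIY.const_mul κ).mul hF)

theorem SmoothOnH.raiseIter {F : ℍ → ℂ} (hF : SmoothOnH F) (κ : ℂ) (n : ℕ) :
    SmoothOnH (raiseIter κ n F) := by
  induction n with
  | zero => exact hF
  | succ n ih => exact ih.raise _

theorem raise_invTwoIY_mul {F : ℍ → ℂ} (hF : SmoothOnH F) (κ : ℂ) :
    raise κ (fun z => invTwoIY z * F z) = fun z => invTwoIY z * raise (κ - 1) F z := by
  funext τ
  simp only [raise]
  rw [dTau_mul smoothOnH_invTwoIY hF, (hasWirtingerAt_invTwoIY τ).dTau_eq]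
  ring

theorem raiseIter_invTwoIY_mul {F : ℍ → ℂ} (hF : SmoothOnH F) (κ : ℂ) (n : ℕ) :
    raiseIter κ n (fun z => invTwoIY z * F z) =
      fun z => invTwoIY z * raiseIter (κ - 1) n F z := by
  induction n with
  | zero => rfl
  | succ n ih =>
    rw [raiseIter, ih, raise_invTwoIY_mul (hF.raiseIter _ n)]
    simp only [raiseIter]
    rw [show κ + 2 * (n : ℂ) - 1 = κ - 1 + 2 * n by ring]

theorem iterate_dTau_twoIY_mul {F : ℍ → ℂ} (hF : SmoothOnH F) (n : ℕ) :
    dTau^[n + 1] (fun z => twoIY z * F z) =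
      fun z => twoIY z * dTau^[n + 1] F z + (n + 1) * dTau^[n] F z := by
  induction n with
  | zero =>
    funext τ
    simp only [zero_add, Function.iterate_one, Function.iterate_zero, id]
    rw [dTau_mul smoothOnH_twoIY hF, (hasWirtingerAt_twoIY τ).dTau_eq]
    push_cast; ring
  | succ n ih =>
    have hn := hF.iterate_dTau n
    have hn1 := hF.iterate_dTau (n + 1)
    funext τ
    rw [Function.iterate_succ_apply', ih,
      dTau_add (smoothOnH_twoIY.mul hn1) (hn.const_mul _), dTau_mul smoothOnH_twoIY hn1,
      dTau_const_mul _ hn, (hasWirtingerAt_twoIY τ).dTau_eq, ← Function.iterate_succ_apply' dTau,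
      ← Function.iterate_succ_apply' dTau]
    push_cast; ring

theorem bol_identity {F : ℍ → ℂ} (hF : SmoothOnH F) (n : ℕ) :
    raiseIter (1 - n) n F = dTau^[n] F := by
  induction n generalizing F with
  | zero => rfl
  | succ n ih =>
    -- Multiplication by `2iy` commutes with `∂_τ^{n+1}` up to a term of lower order and only shifts
    -- the weights of the raising operators, so it suffices to know the identity for `F / (2iy)`.
    set K : ℍ → ℂ := fun z => invTwoIY z * F z with hKdef
    have hK : SmoothOnH K := smoothOnH_invTwoIY.mul hF
    have hraise : raiseIter (1 - (n + 1 : ℕ)) n F = fun z => twoIY z * dTau^[n] K z := by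
      rw [← ih hK, hKdef, raiseIter_invTwoIY_mul hF]
      funext z
      rw [← mul_assoc, twoIY_mul_invTwoIY, one_mul, Nat.cast_succ, sub_add_eq_sub_sub]
    have hFK : F = fun z => twoIY z * K z := by
      funext z; rw [hKdef, ← mul_assoc, twoIY_mul_invTwoIY, one_mul]
    rw [raiseIter, hraise]
    conv_rhs => rw [hFK, iterate_dTau_twoIY_mul hK]
    funext τ
    simp only [raise]
    rw [dTau_mul smoothOnH_twoIY (hK.iterate_dTau n), (hasWirtingerAt_twoIY τ).dTau_eq,
      ← Function.iterate_succ_apply' dTau]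
    push_cast
    linear_combination (n : ℂ) * dTau^[n] K τ * twoIY_mul_invTwoIY τ

theorem raise_raiseIter_neg {F : ℍ → ℂ} (hF : SmoothOnH F) (n : ℕ) :
    raise n (raiseIter (-n) n F) = dTau^[n + 1] F := by
  have h := bol_identity hF (n + 1)
  rw [raiseIter] at h
  push_cast at h
  rwa [show (1 : ℂ) - (n + 1) + 2 * n = n by ring, show (1 : ℂ) - (n + 1) = -n by ring] at h

theorem dTauBar_mul_raise {n : ℕ} {F G : ℍ → ℂ} (hF : IsHarmonicNeg n F) (hG : SmoothOnH G)
    (hhol : ∀ τ, dTauBar (raise n G) τ = 0) (τ : ℍ) :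
    dTauBar (fun z => F z * raise n G z) τ = dTau (fun z => dTauBar F z * G z) τ := by
  rw [dTauBar_mul hF.smooth (hG.raise n), dTau_mul hF.smooth.dTauBar hG, hF.dTau_dTauBar, hhol,
    raise]
  ring

/-! ### Modular transformations -/

theorem HasWirtingerAt.comp_smul {F : ℍ → ℂ} {a b : ℂ} (M : SL(2, ℤ)) {τ : ℍ}
    (h : HasWirtingerAt F a b (M • τ)) :
    HasWirtingerAt (fun z => F (M • z)) (a / denom M τ ^ 2) (b / conj (denom M τ) ^ 2) τ := by
  have hM : HasDerivAt (fun z : ℂ => ((M • ofComplex z : ℍ) : ℂ)) (1 / denom M τ ^ 2) τ := by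
    have hdet : (M : GL (Fin 2) ℝ).val.det = 1 := by
      rw [← Matrix.GeneralLinearGroup.val_det_apply]; simp
    have hstrict := (hasStrictDerivAt_smul (g := (M : GL (Fin 2) ℝ))
      (by rw [hdet]; exact one_pos) τ).hasDerivAt
    rwa [hdet, Complex.ofReal_one] at hstrict
  have hF : HasFDerivAt (F ∘ ofComplex) (wirtinger a b) ((M • ofComplex (τ : ℂ) : ℍ) : ℂ) := by
    rw [ofComplex_apply]; exact h
  refine HasFDerivAt.congr_fderiv (f := (fun z => F (M • z)) ∘ ofComplex)
    ((hF.comp (τ : ℂ) (hM.hasFDerivAt.restrictScalars ℝ)).congr_of_eventuallyEq ?_) ?_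
  · exact Eventually.of_forall fun z => by simp
  · ext v
    simp only [one_div, ContinuousLinearMap.comp_apply,
      ContinuousLinearMap.coe_restrictScalars', ContinuousLinearMap.toSpanSingleton_apply,
      smul_eq_mul, wirtinger_apply, map_mul, map_inv₀, map_pow]
    ring

theorem hasWirtingerAt_denom_zpow (M : SL(2, ℤ)) (k : ℤ) (τ : ℍ) :
    HasWirtingerAt (fun z : ℍ => denom M z ^ k) (k * (M 1 0 : ℂ) * denom M τ ^ (k - 1)) 0 τ :=
  hasWirtingerAt_of_hasDerivAt (f := fun z => denom M z ^ k) <| by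
    simpa using! hasDerivAt_denom_zpow (M : GL (Fin 2) ℝ) k τ

theorem twoIY_eq_denom_mul (M : SL(2, ℤ)) (τ : ℍ) :
    twoIY τ = denom M τ * conj (denom M τ) * twoIY (M • τ) := by
  have hd := Complex.normSq_pos.2 (denom_ne_zero (M : GL (Fin 2) ℝ) τ)
  rw [twoIY_eq, twoIY_eq, ModularGroup.im_smul_eq_div_normSq, Complex.mul_conj]
  push_cast
  field_simp [Complex.ofReal_ne_zero.2 hd.ne']

theorem denom_sub_conj (M : SL(2, ℤ)) (τ : ℍ) :
    denom M τ - conj (denom M τ) = M 1 0 * twoIY τ := by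
  rw [ModularGroup.denom_apply, twoIY]
  simp only [map_add, map_mul, map_intCast]
  ring

section Vector

variable {D : Type*} [Fintype D]

/-- `H(Mτ) = (cτ + d)^k A H(τ)`. -/
def TransformsBy (M : SL(2, ℤ)) (A : Matrix D D ℂ) (k : ℤ) (H : ℍ → D → ℂ) : Prop :=
  ∀ τ γ, H (M • τ) γ = denom M τ ^ k * A.mulVec (H τ) γ

variable {M : SL(2, ℤ)} {A : Matrix D D ℂ} {k : ℤ} {H : ℍ → D → ℂ}

theorem isModular_iff_transformsBy {R : Mp2Z → Matrix D D ℂ → Prop} :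
    IsModular R k H ↔ ∀ g A, R g A → TransformsBy g.mat A k H := by
  refine forall₃_congr fun g A _ => forall_congr' fun τ => ?_
  rw [zpow_mul, show g.phi τ ^ (2 : ℤ) = denom g.mat τ from g.sq τ, funext_iff]
  rfl

namespace TransformsBy

theorem const_mul (h : TransformsBy M A k H) (c : ℂ) :
    TransformsBy M A k fun τ γ => c * H τ γ := by
  intro τ γ
  change c * H (M • τ) γ = _ * A.mulVec (c • H τ) γ
  rw [h τ γ, Matrix.mulVec_smul, Pi.smul_apply, smul_eq_mul, mul_left_comm]

theorem hasWirtingerAt (h : TransformsBy M A k H) (hH : ∀ γ, SmoothOnH fun z => H z γ)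
    (τ : ℍ) (γ : D) :
    HasWirtingerAt (fun z => H (M • z) γ)
      (k * (M 1 0 : ℂ) * denom M τ ^ (k - 1) * A.mulVec (H τ) γ +
        denom M τ ^ k * A.mulVec (fun δ => dTau (fun z => H z δ) τ) γ)
      (denom M τ ^ k * A.mulVec (fun δ => dTauBar (fun z => H z δ) τ) γ) τ := by
  have hfun : (fun z => H (M • z) γ) = fun z : ℍ => denom M z ^ k * ∑ δ, A γ δ * H z δ :=
    funext fun z => h z γ
  rw [hfun]
  refine ((hasWirtingerAt_denom_zpow M k τ).mul (HasWirtingerAt.sum fun δ _ =>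
    ((hH δ).hasWirtingerAt τ).const_mul (A γ δ))).congr_coeff ?_ ?_
  · rfl
  · rw [zero_mul, zero_add]; rfl

theorem dTau_apply (h : TransformsBy M A k H) (hH : ∀ γ, SmoothOnH fun z => H z γ)
    (τ : ℍ) (γ : D) :
    dTau (fun z => H z γ) (M • τ) =
      (k * (M 1 0 : ℂ) * denom M τ ^ (k - 1) * A.mulVec (H τ) γ +
        denom M τ ^ k * A.mulVec (fun δ => dTau (fun z => H z δ) τ) γ) * denom M τ ^ 2 := by
  rw [← (h.hasWirtingerAt hH τ γ).dTau_eq,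
    (((hH γ).hasWirtingerAt (M • τ)).comp_smul M).dTau_eq,
    div_mul_cancel₀ _ (pow_ne_zero _ (denom_ne_zero _ τ))]

theorem dTauBar_apply (h : TransformsBy M A k H) (hH : ∀ γ, SmoothOnH fun z => H z γ)
    (τ : ℍ) (γ : D) :
    dTauBar (fun z => H z γ) (M • τ) =
      denom M τ ^ k * A.mulVec (fun δ => dTauBar (fun z => H z δ) τ) γ *
        conj (denom M τ) ^ 2 := by
  have hconj : conj (denom M τ) ≠ 0 := by simp [denom_ne_zero]
  rw [← (h.hasWirtingerAt hH τ γ).dTauBar_eq,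
    (((hH γ).hasWirtingerAt (M • τ)).comp_smul M).dTauBar_eq,
    div_mul_cancel₀ _ (pow_ne_zero _ hconj)]

theorem raise_apply (h : TransformsBy M A k H) (hH : ∀ γ, SmoothOnH fun z => H z γ) :
    TransformsBy M A (k + 2) fun τ γ => raise k (fun z => H z γ) τ := by
  intro τ γ
  have hd : denom M τ ≠ 0 := denom_ne_zero _ τ
  have hmulVec : A.mulVec (fun δ => raise k (fun z => H z δ) τ) γ =
      A.mulVec (fun δ => dTau (fun z => H z δ) τ) γ + k * invTwoIY τ * A.mulVec (H τ) γ := by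
    change A.mulVec ((fun δ => dTau (fun z => H z δ) τ) + (k * invTwoIY τ) • H τ) γ = _
    rw [Matrix.mulVec_add, Matrix.mulVec_smul]
    rfl
  have hinv : invTwoIY (M • τ) = denom M τ * conj (denom M τ) * invTwoIY τ := by
    have hy := twoIY_ne_zero (M • τ)
    rw [invTwoIY, invTwoIY, twoIY_eq_denom_mul M τ]
    have hconj : conj (denom M τ) ≠ 0 := by simp [denom_ne_zero]
    field_simp
  have hdenom : (M 1 0 : ℂ) + conj (denom M τ) * invTwoIY τ = denom M τ * invTwoIY τ := by
    linear_combination -(M 1 0 : ℂ) * twoIY_mul_invTwoIY τ - invTwoIY τ * denom_sub_conj M τ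
  have hpow : denom M τ ^ k = denom M τ ^ (k - 1) * denom M τ := by
    rw [← zpow_add_one₀ hd, sub_add_cancel]
  rw [hmulVec]
  simp only [raise]
  rw [h.dTau_apply hH, h τ γ, hinv, zpow_add₀ hd, hpow, zpow_ofNat]
  linear_combination k * A.mulVec (H τ) γ * denom M τ ^ (k - 1) * denom M τ ^ 2 * hdenom

theorem raiseIter_apply (h : TransformsBy M A k H) (hH : ∀ γ, SmoothOnH fun z => H z γ)
    (n : ℕ) : TransformsBy M A (k + 2 * n) fun τ γ => raiseIter k n (fun z => H z γ) τ := by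
  induction n with
  | zero => simpa [raiseIter] using h
  | succ n ih =>
    have hsucc := ih.raise_apply fun γ => (hH γ).raiseIter k n
    push_cast at hsucc ⊢
    rwa [show k + 2 * ((n : ℤ) + 1) = k + 2 * n + 2 by ring]

end TransformsBy

end Vector

/-! ### Invariant closed 1-forms on the upper half plane -/

theorem exists_primitive {P B : ℍ → ℂ} (hP : SmoothOnH P) (hB : SmoothOnH B)
    (h : ∀ τ, dTauBar P τ = dTau B τ) : ∃ Φ : ℍ → ℂ, ∀ τ, HasWirtingerAt Φ (P τ) (B τ) τ := by
  let form : ℂ → ℂ →L[ℝ] ℂ := fun z => wirtinger ((P ∘ ofComplex) z) ((B ∘ ofComplex) z)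
  have hform : ∀ τ : ℍ, HasFDerivAt form
      ((wirtinger (dTau P τ) (dTauBar P τ)).smulRight (ContinuousLinearMap.id ℝ ℂ) +
        (wirtinger (dTau B τ) (dTauBar B τ)).smulRight (Complex.conjCLE : ℂ →L[ℝ] ℂ)) (τ : ℂ) :=
    fun τ => (HasFDerivAt.smul_const (hP.hasWirtingerAt τ) _).add
      (HasFDerivAt.smul_const (hB.hasWirtingerAt τ) (Complex.conjCLE : ℂ →L[ℝ] ℂ))
  have hclosed : ∀ z : ℂ, 0 < z.im → ∀ v w : ℂ, fderiv ℝ form z v w = fderiv ℝ form z w v := by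
    intro z hz v w
    rw [show fderiv ℝ form z = _ from (hform ⟨z, hz⟩).fderiv]
    simp only [add_apply, smul_apply, ContinuousLinearMap.smulRight_apply, wirtinger_apply, h,
      smul_eq_mul, ContinuousLinearMap.id_apply, ContinuousLinearEquiv.coe_coe,
      Complex.conjCLE_apply]
    ring
  obtain ⟨Φ, hΦ⟩ := (convex_halfSpace_im_gt 0).exists_forall_hasFDerivAt_of_fderiv_symmetric
    isOpen_upperHalfPlaneSet
    (fun z hz => (hform ⟨z, hz⟩).differentiableAt.differentiableWithinAt) hclosed
  refine ⟨fun τ => Φ τ, fun τ => hasWirtingerAt_of_hasFDerivAt ?_⟩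
  simpa [form] using hΦ τ τ.im_pos

theorem eq_of_hasWirtingerAt_zero {F : ℍ → ℂ} (h : ∀ τ, HasWirtingerAt F 0 0 τ) (τ τ' : ℍ) :
    F τ = F τ' := by
  have hzero : wirtinger 0 0 = 0 := by ext; simp
  have hconst := isOpen_upperHalfPlaneSet.is_const_of_fderiv_eq_zero (𝕜 := ℝ)
    (convex_halfSpace_im_gt 0).isPreconnected (f := F ∘ ofComplex)
    (fun z hz => (HasFDerivAt.differentiableAt (h ⟨z, hz⟩)).differentiableWithinAt)
    (fun z hz => (HasFDerivAt.fderiv (h ⟨z, hz⟩)).trans hzero) τ.im_pos τ'.im_pos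
  simpa using hconst

theorem map_modularGroup_T_pow_twelve {A : Type*} [CommGroup A] (χ : SL(2, ℤ) →* A) :
    χ ModularGroup.T ^ 12 = 1 := by
  have hS : ModularGroup.S ^ 4 = 1 := by decide
  have hST : (ModularGroup.S * ModularGroup.T) ^ 3 = ModularGroup.S ^ 2 := by decide
  replace hS := congrArg χ hS
  replace hST := congrArg χ hST
  simp only [map_pow, map_mul, map_one, mul_pow] at hS hST
  have hT : χ ModularGroup.T ^ 3 = (χ ModularGroup.S)⁻¹ := by
    rw [eq_inv_iff_mul_eq_one]
    refine mul_left_cancel (a := χ ModularGroup.S ^ 2) ?_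
    calc _ = χ ModularGroup.S ^ 3 * χ ModularGroup.T ^ 3 := by
          rw [pow_succ (χ ModularGroup.S) 2]; ac_rfl
      _ = _ := by rw [hST, mul_one]
  rw [show 12 = 3 * 4 from rfl, pow_mul, hT, inv_pow, hS, inv_one]

section InvariantForm

variable {P B Φ : ℍ → ℂ}

theorem primitive_smul_sub (hΦ : ∀ τ, HasWirtingerAt Φ (P τ) (B τ) τ)
    (hP : ∀ (M : SL(2, ℤ)) τ, P (M • τ) = denom M τ ^ 2 * P τ)
    (hB : ∀ (M : SL(2, ℤ)) τ, B (M • τ) = conj (denom M τ) ^ 2 * B τ) (M : SL(2, ℤ)) (τ τ' : ℍ) :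
    Φ (M • τ) - Φ τ = Φ (M • τ') - Φ τ' := by
  have hzero : ∀ z, HasWirtingerAt (fun z => Φ (M • z) + (-1) * Φ z) 0 0 z := fun z => by
    have hd : denom M z ≠ 0 := denom_ne_zero _ z
    have hd' : conj (denom M z) ≠ 0 := by simp [denom_ne_zero]
    refine (((hΦ (M • z)).comp_smul M).add ((hΦ z).const_mul (-1))).congr_coeff ?_ ?_
    · rw [hP]; field_simp; ring
    · rw [hB]; field_simp; ring
  linear_combination eq_of_hasWirtingerAt_zero hzero τ τ'

/-- The periods `Φ(Mτ) - Φ(τ)` form a homomorphism `SL₂(ℤ) → ℂ`, hence vanish. -/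
theorem primitive_T_smul (hΦ : ∀ τ, HasWirtingerAt Φ (P τ) (B τ) τ)
    (hP : ∀ (M : SL(2, ℤ)) τ, P (M • τ) = denom M τ ^ 2 * P τ)
    (hB : ∀ (M : SL(2, ℤ)) τ, B (M • τ) = conj (denom M τ) ^ 2 * B τ) (τ : ℍ) :
    Φ (ModularGroup.T • τ) = Φ τ := by
  let period : SL(2, ℤ) →* Multiplicative ℂ :=
    { toFun := fun M => .ofAdd (Φ (M • τ) - Φ τ)
      map_one' := by simp
      map_mul' := fun M N => by
        rw [← ofAdd_add, mul_smul, ← primitive_smul_sub hΦ hP hB M (N • τ), sub_add_sub_cancel] }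
  have htorsion : (12 : ℕ) • (Φ (ModularGroup.T • τ) - Φ τ) = 0 :=
    congrArg Multiplicative.toAdd (map_modularGroup_T_pow_twelve period)
  exact sub_eq_zero.1 ((smul_eq_zero_iff_right (by norm_num)).1 htorsion)

end InvariantForm

/-- The point `x + iy` for `y > 0`; a junk value for `y ≤ 0`. -/
def pt (x y : ℝ) : ℍ := ofComplex (x + y * Complex.I)

theorem coe_pt (x : ℝ) {y : ℝ} (hy : 0 < y) : (pt x y : ℂ) = x + y * Complex.I := by
  rw [pt, ofComplex_apply_of_im_pos (by simpa using hy)]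

theorem pt_im (x : ℝ) {y : ℝ} (hy : 0 < y) : (pt x y).im = y := by
  rw [← coe_im, coe_pt x hy]; simp

theorem pt_re_im (τ : ℍ) : pt τ.re τ.im = τ := by
  apply UpperHalfPlane.ext
  rw [coe_pt _ τ.im_pos]
  exact Complex.re_add_im (τ : ℂ)

theorem T_smul_pt (x : ℝ) {y : ℝ} (hy : 0 < y) : ModularGroup.T • pt x y = pt (x + 1) y := by
  apply UpperHalfPlane.ext
  rw [modular_T_smul, coe_vadd, coe_pt _ hy, coe_pt _ hy]
  push_cast; ring

theorem HasWirtingerAt.hasDerivAt_re {F : ℍ → ℂ} {a b : ℂ} {x y : ℝ} (hy : 0 < y)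
    (h : HasWirtingerAt F a b (pt x y)) : HasDerivAt (fun x : ℝ => F (pt x y)) (a + b) x := by
  rw [HasWirtingerAt, coe_pt x hy] at h
  have hline : HasDerivAt (fun x : ℝ => (x : ℂ) + y * Complex.I) 1 x :=
    (Complex.ofRealCLM.hasDerivAt (x := x)).add_const _ |>.congr_deriv (by simp)
  refine (h.comp_hasDerivAt x hline).congr_deriv ?_
  simp

theorem HasWirtingerAt.hasDerivAt_im {F : ℍ → ℂ} {a b : ℂ} {x y : ℝ} (hy : 0 < y)
    (h : HasWirtingerAt F a b (pt x y)) :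
    HasDerivAt (fun y : ℝ => F (pt x y)) (Complex.I * (a - b)) y := by
  rw [HasWirtingerAt, coe_pt x hy] at h
  have hline : HasDerivAt (fun y : ℝ => (x : ℂ) + y * Complex.I) Complex.I y :=
    (((Complex.ofRealCLM.hasDerivAt (x := y)).mul_const Complex.I).const_add _).congr_deriv
      (by simp)
  refine (h.comp_hasDerivAt y hline).congr_deriv ?_
  rw [wirtinger_apply, Complex.conj_I]
  ring

theorem SmoothOnH.continuous_pt {F : ℍ → ℂ} (h : SmoothOnH F) {y : ℝ} (hy : 0 < y) :
    Continuous fun x : ℝ => F (pt x y) :=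
  h.continuousOn.comp_continuous (f := fun x : ℝ => (x : ℂ) + y * Complex.I) (by fun_prop)
    (fun x => by simpa using hy)

theorem integral_eq_zero_of_closed_of_invariant {P B : ℍ → ℂ} (hPs : SmoothOnH P)
    (hBs : SmoothOnH B) (h : ∀ τ, dTauBar P τ = dTau B τ)
    (hP : ∀ (M : SL(2, ℤ)) τ, P (M • τ) = denom M τ ^ 2 * P τ)
    (hB : ∀ (M : SL(2, ℤ)) τ, B (M • τ) = conj (denom M τ) ^ 2 * B τ) {y : ℝ} (hy : 0 < y) :
    ∫ x in (0 : ℝ)..1, (P (pt x y) + B (pt x y)) = 0 := by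
  obtain ⟨Φ, hΦ⟩ := exists_primitive hPs hBs h
  have hperiod := primitive_T_smul hΦ hP hB (pt 0 y)
  rw [T_smul_pt 0 hy, zero_add] at hperiod
  rw [intervalIntegral.integral_eq_sub_of_hasDerivAt
    (fun x _ => (hΦ (pt x y)).hasDerivAt_re hy)
    (((hPs.continuous_pt hy).add (hBs.continuous_pt hy)).intervalIntegrable _ _),
    hperiod, sub_self]

section Pairing

variable {D : Type*} [Fintype D]

theorem mulVec_dotProduct_mulVec_of_transpose_mul_eq_one {R : Type*} [CommSemiring R]
    [DecidableEq D] {A A' : Matrix D D R} (h : A.transpose * A' = 1) (v w : D → R) :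
    A.mulVec v ⬝ᵥ A'.mulVec w = v ⬝ᵥ w := by
  rw [← Matrix.vecMul_transpose, ← Matrix.dotProduct_mulVec, Matrix.mulVec_mulVec, h,
    Matrix.one_mulVec]

variable [DecidableEq D] {M : SL(2, ℤ)} {A A' : Matrix D D ℂ}

theorem TransformsBy.sum_mul {k l : ℤ} {f g : ℍ → D → ℂ} (hA : A.transpose * A' = 1)
    (hf : TransformsBy M A k f) (hg : TransformsBy M A' l g) (τ : ℍ) :
    ∑ γ, f (M • τ) γ * g (M • τ) γ = denom M τ ^ (k + l) * ∑ γ, f τ γ * g τ γ := by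
  have hdot := mulVec_dotProduct_mulVec_of_transpose_mul_eq_one hA (f τ) (g τ)
  simp only [dotProduct] at hdot
  rw [← hdot, Finset.mul_sum, zpow_add₀ (denom_ne_zero _ τ)]
  exact Finset.sum_congr rfl fun γ _ => by rw [hf τ γ, hg τ γ]; ring

theorem TransformsBy.sum_dTauBar_mul {k l : ℤ} {f g : ℍ → D → ℂ} (hA : A.transpose * A' = 1)
    (hf : TransformsBy M A k f) (hfs : ∀ γ, SmoothOnH fun z => f z γ)
    (hg : TransformsBy M A' l g) (τ : ℍ) :
    ∑ γ, dTauBar (fun z => f z γ) (M • τ) * g (M • τ) γ =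
      denom M τ ^ (k + l) * conj (denom M τ) ^ 2 * ∑ γ, dTauBar (fun z => f z γ) τ * g τ γ := by
  have hdot := mulVec_dotProduct_mulVec_of_transpose_mul_eq_one hA
    (fun γ => dTauBar (fun z => f z γ) τ) (g τ)
  simp only [dotProduct] at hdot
  rw [← hdot, Finset.mul_sum, zpow_add₀ (denom_ne_zero _ τ)]
  exact Finset.sum_congr rfl fun γ _ => by rw [hf.dTauBar_apply hfs τ γ, hg τ γ]; ring

theorem integral_pairing_eq_zero {n : ℕ} {f g : ℍ → D → ℂ}
    (hf : ∀ γ, IsHarmonicNeg n fun z => f z γ) (hg : ∀ γ, SmoothOnH fun z => g z γ)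
    (hhol : ∀ γ τ, dTauBar (raise n fun z => g z γ) τ = 0)
    (hmod : ∀ M : SL(2, ℤ), ∃ A A' : Matrix D D ℂ, A.transpose * A' = 1 ∧
      TransformsBy M A (-n) f ∧ TransformsBy M A' n g) {y : ℝ} (hy : 0 < y) :
    ∫ x in (0 : ℝ)..1, (∑ γ, f (pt x y) γ * raise n (fun z => g z γ) (pt x y) +
      ∑ γ, dTauBar (fun z => f z γ) (pt x y) * g (pt x y) γ) = 0 := by
  have hP := fun γ => (hf γ).smooth.mul ((hg γ).raise n)
  have hB := fun γ => (hf γ).smooth.dTauBar.mul (hg γ)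
  refine integral_eq_zero_of_closed_of_invariant
    (P := fun τ => ∑ γ, f τ γ * raise n (fun z => g z γ) τ)
    (B := fun τ => ∑ γ, dTauBar (fun z => f z γ) τ * g τ γ)
    (SmoothOnH.sum fun γ _ => hP γ) (SmoothOnH.sum fun γ _ => hB γ)
    (fun τ => ?_) (fun M τ => ?_) (fun M τ => ?_) hy
  · rw [(HasWirtingerAt.sum fun γ _ => (hP γ).hasWirtingerAt τ).dTauBar_eq,
      (HasWirtingerAt.sum fun γ _ => (hB γ).hasWirtingerAt τ).dTau_eq]
    exact Finset.sum_congr rfl fun γ _ => dTauBar_mul_raise (hf γ) (hg γ) (hhol γ) τ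
  · obtain ⟨A, A', hA, hfM, hgM⟩ := hmod M
    have hraise := hgM.raise_apply hg
    rw [Int.cast_natCast] at hraise
    rw [TransformsBy.sum_mul hA hfM hraise, neg_add_cancel_left, zpow_ofNat]
  · obtain ⟨A, A', hA, hfM, hgM⟩ := hmod M
    rw [TransformsBy.sum_dTauBar_mul hA hfM (fun γ => (hf γ).smooth) hgM, neg_add_cancel,
      zpow_zero, one_mul]

end Pairing

/-! ### Fourier coefficients along horizontal lines -/

/-- The exponential `e(νx)` in a real variable `x`. -/
def fchar (ν : ℚ) (x : ℝ) : ℂ := Complex.exp (2 * Real.pi * Complex.I * (ν : ℂ) * (x : ℂ))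

theorem fchar_add (ν μ : ℚ) (x : ℝ) : fchar (ν + μ) x = fchar ν x * fchar μ x := by
  rw [fchar, fchar, fchar, ← Complex.exp_add]; push_cast; ring_nf

theorem fchar_zero (x : ℝ) : fchar 0 x = 1 := by simp [fchar]

theorem fchar_mul_fchar_neg (ν : ℚ) (x : ℝ) : fchar ν x * fchar (-ν) x = 1 := by
  rw [← fchar_add, add_neg_cancel, fchar_zero]

theorem norm_fchar (ν : ℚ) (x : ℝ) : ‖fchar ν x‖ = 1 := by
  rw [fchar, show 2 * Real.pi * Complex.I * (ν : ℂ) * (x : ℂ) =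
    ((2 * Real.pi * ν * x : ℝ) : ℂ) * Complex.I by push_cast; ring, Complex.norm_exp_ofReal_mul_I]

theorem fchar_add_one (ν : ℚ) (x : ℝ) : fchar ν (x + 1) = expUnit ν * fchar ν x := by
  rw [fchar, fchar, expUnit, ← Complex.exp_add]; push_cast; ring_nf

theorem hasDerivAt_fchar (ν : ℚ) (x : ℝ) :
    HasDerivAt (fchar ν) (2 * Real.pi * Complex.I * ν * fchar ν x) x := by
  have hlin : HasDerivAt (fun x : ℝ => 2 * Real.pi * Complex.I * (ν : ℂ) * (x : ℂ))
      (2 * Real.pi * Complex.I * ν) x :=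
    ((Complex.ofRealCLM.hasDerivAt (x := x)).const_mul _).congr_deriv (by simp)
  exact hlin.cexp.congr_deriv (mul_comm _ _)

@[fun_prop]
theorem continuous_fchar (ν : ℚ) : Continuous (fchar ν) := by
  unfold fchar; fun_prop

theorem expUnit_intCast (j : ℤ) : expUnit j = 1 := (expUnit_eq_one_iff _).2 ⟨j, rfl⟩

theorem expUnit_neg_mul (q : ℚ) : expUnit (-q) * expUnit q = 1 := by
  rw [← expUnit_add, neg_add_cancel, expUnit_zero]

theorem integral_fchar_intCast (j : ℤ) :
    ∫ x in (0 : ℝ)..1, fchar j x = if j = 0 then 1 else 0 := by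
  split_ifs with h
  · subst h; simp [fchar]
  · have hc : 2 * Real.pi * Complex.I * ((j : ℚ) : ℂ) ≠ 0 :=
      mul_ne_zero Complex.two_pi_I_ne_zero (by exact_mod_cast h)
    have hperiodic : fchar j 1 = fchar j 0 := by
      simpa [expUnit_intCast] using fchar_add_one j 0
    have hint := intervalIntegral.integral_eq_sub_of_hasDerivAt
      (fun x (_ : x ∈ Set.uIcc (0 : ℝ) 1) => hasDerivAt_fchar j x)
      (((continuous_fchar j).const_mul _).intervalIntegrable _ _)
    rw [hperiodic, sub_self, intervalIntegral.integral_const_mul] at hint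
    exact (mul_eq_zero.1 hint).resolve_left hc

/-- The `ν`-th Fourier coefficient `∫₀¹ F(x + iy) e(-νx) dx`. -/
def fcoeff (ν : ℚ) (F : ℍ → ℂ) (y : ℝ) : ℂ := ∫ x in (0 : ℝ)..1, F (pt x y) * fchar (-ν) x

/-- The condition `F(τ + 1) = e(q) F(τ)`: the Fourier exponents of `F` lie in `ℤ + q`. -/
def QuasiPeriodic (q : ℚ) (F : ℍ → ℂ) : Prop := ∀ τ, F (ModularGroup.T • τ) = expUnit q * F τ

theorem denom_modularGroup_T (τ : ℍ) : denom ModularGroup.T τ = 1 := by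
  simp [ModularGroup.denom_apply, ModularGroup.coe_T]

namespace QuasiPeriodic

variable {q : ℚ} {F G : ℍ → ℂ}

theorem pt_add_one (h : QuasiPeriodic q F) (x : ℝ) {y : ℝ} (hy : 0 < y) :
    F (pt (x + 1) y) = expUnit q * F (pt x y) := by rw [← T_smul_pt x hy, h]

theorem int_add (h : QuasiPeriodic q F) (j : ℤ) : QuasiPeriodic (j + q) F := fun τ => by
  rw [h, expUnit_add, expUnit_intCast, one_mul]

theorem hasWirtingerAt_T_smul (h : QuasiPeriodic q F) (hF : SmoothOnH F) (τ : ℍ) :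
    HasWirtingerAt (fun z => expUnit q * F z) (dTau F (ModularGroup.T • τ))
      (dTauBar F (ModularGroup.T • τ)) τ := by
  have hT := (hF.hasWirtingerAt (ModularGroup.T • τ)).comp_smul ModularGroup.T
  rw [funext h, denom_modularGroup_T] at hT
  simpa using hT

theorem dTau (h : QuasiPeriodic q F) (hF : SmoothOnH F) : QuasiPeriodic q (dTau F) := fun τ =>
  (h.hasWirtingerAt_T_smul hF τ).dTau_eq.symm.trans
    ((hF.hasWirtingerAt τ).const_mul (expUnit q)).dTau_eq

theorem dTauBar (h : QuasiPeriodic q F) (hF : SmoothOnH F) : QuasiPeriodic q (dTauBar F) :=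
  fun τ => (h.hasWirtingerAt_T_smul hF τ).dTauBar_eq.symm.trans
    ((hF.hasWirtingerAt τ).const_mul (expUnit q)).dTauBar_eq

theorem add (h : QuasiPeriodic q F) (h' : QuasiPeriodic q G) :
    QuasiPeriodic q fun z => F z + G z := fun τ => by beta_reduce; rw [h, h']; ring

theorem const_mul (h : QuasiPeriodic q F) (c : ℂ) : QuasiPeriodic q fun z => c * F z :=
  fun τ => by beta_reduce; rw [h]; ring

theorem invTwoIY_mul (h : QuasiPeriodic q F) : QuasiPeriodic q fun z => invTwoIY z * F z :=
  fun τ => by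
    have hτ := twoIY_eq_denom_mul ModularGroup.T τ
    rw [denom_modularGroup_T, map_one, one_mul, one_mul] at hτ
    simp only [h τ, invTwoIY, ← hτ]
    ring

theorem partialX (h : QuasiPeriodic q F) (hF : SmoothOnH F) : QuasiPeriodic q (partialX F) := by
  rw [funext (partialX_eq F)]
  exact (h.dTau hF).add (h.dTauBar hF)

theorem iterate_dTau (h : QuasiPeriodic q F) (hF : SmoothOnH F) (n : ℕ) :
    QuasiPeriodic q (_root_.dTau^[n] F) := by
  induction n with
  | zero => exact h
  | succ n ih =>
    rw [Function.iterate_succ_apply']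
    exact ih.dTau (hF.iterate_dTau n)

theorem raise (h : QuasiPeriodic q F) (hF : SmoothOnH F) (κ : ℂ) :
    QuasiPeriodic q (raise κ F) := fun τ => by
  have hsum := (h.dTau hF).add (h.invTwoIY_mul.const_mul κ) τ
  rw [_root_.raise, _root_.raise, mul_assoc, mul_assoc]
  exact hsum

theorem raiseIter (h : QuasiPeriodic q F) (hF : SmoothOnH F) (κ : ℂ) (n : ℕ) :
    QuasiPeriodic q (raiseIter κ n F) := by
  induction n with
  | zero => exact h
  | succ n ih => exact ih.raise (hF.raiseIter κ n) _

end QuasiPeriodic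

theorem hasDerivAt_intervalIntegral_of_continuousOn {E : Type*} [NormedAddCommGroup E]
    [NormedSpace ℝ E] {a b t : ℝ} {f f' : ℝ → ℝ → E} {U : Set ℝ} (hU : IsOpen U) (ht : t ∈ U)
    (hf : ∀ s ∈ U, Continuous (f s)) (hf' : ContinuousOn (Function.uncurry f') (U ×ˢ Set.univ))
    (hderiv : ∀ s ∈ U, ∀ x, HasDerivAt (fun s => f s x) (f' s x) s) :
    HasDerivAt (fun s => ∫ x in a..b, f s x) (∫ x in a..b, f' t x) t := by
  obtain ⟨K, hK, htK, hKU⟩ := exists_compact_subset hU ht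
  obtain ⟨C, hC⟩ := (hK.prod (isCompact_uIcc (a := a) (b := b))).exists_bound_of_continuousOn
    (hf'.mono (Set.prod_mono hKU (Set.subset_univ _)))
  have hf't : Continuous (f' t) := hf'.comp_continuous (f := fun x => (t, x)) (by fun_prop)
    fun x => ⟨ht, Set.mem_univ x⟩
  refine (intervalIntegral.hasDerivAt_integral_of_dominated_loc_of_deriv_le
    (bound := fun _ => C) (mem_interior_iff_mem_nhds.1 htK) ?_ ?_ ?_ ?_ ?_ ?_).2
  · filter_upwards [hU.mem_nhds ht] with s hs using (hf s hs).aestronglyMeasurable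
  · exact (hf t ht).intervalIntegrable _ _
  · exact hf't.aestronglyMeasurable
  · exact Eventually.of_forall fun x hx s hs => hC (s, x) ⟨hs, Set.uIoc_subset_uIcc hx⟩
  · exact intervalIntegrable_const
  · exact Eventually.of_forall fun x _ s hs => hderiv s (hKU hs) x

section FCoeff

variable {ν : ℚ} {F G : ℍ → ℂ} {y : ℝ}

theorem SmoothOnH.continuous_mul_fchar (hF : SmoothOnH F) (ν : ℚ) (hy : 0 < y) :
    Continuous fun x => F (pt x y) * fchar ν x :=
  (hF.continuous_pt hy).mul (continuous_fchar ν)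

theorem fcoeff_add (hF : SmoothOnH F) (hG : SmoothOnH G) (ν : ℚ) (hy : 0 < y) :
    fcoeff ν (fun z => F z + G z) y = fcoeff ν F y + fcoeff ν G y := by
  simp only [fcoeff, add_mul]
  exact intervalIntegral.integral_add ((hF.continuous_mul_fchar _ hy).intervalIntegrable _ _)
    ((hG.continuous_mul_fchar _ hy).intervalIntegrable _ _)

theorem fcoeff_const_mul (c : ℂ) (ν : ℚ) :
    fcoeff ν (fun z => c * F z) y = c * fcoeff ν F y := by
  simp only [fcoeff, mul_assoc]
  exact intervalIntegral.integral_const_mul _ _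

theorem fcoeff_mul_invTwoIY_mul (c : ℂ) (ν : ℚ) (hy : 0 < y) :
    fcoeff ν (fun z => c * invTwoIY z * F z) y = c / (2 * Complex.I * y) * fcoeff ν F y := by
  rw [← fcoeff_const_mul]
  simp only [fcoeff, invTwoIY, twoIY_eq, pt_im _ hy, div_eq_mul_inv]

theorem norm_fcoeff_le (ν : ℚ) {C : ℝ} (hC : ∀ x, ‖F (pt x y)‖ ≤ C) : ‖fcoeff ν F y‖ ≤ C := by
  simpa [fcoeff] using intervalIntegral.norm_integral_le_of_norm_le_const (a := 0) (b := 1)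
    (f := fun x => F (pt x y) * fchar (-ν) x) fun x _ => by
      rw [norm_mul, norm_fchar, mul_one]; exact hC x

theorem norm_fcoeff_le_integral (F : ℍ → ℂ) (ν : ℚ) (y : ℝ) :
    ‖fcoeff ν F y‖ ≤ ∫ x in (0 : ℝ)..1, ‖F (pt x y)‖ := by
  refine (intervalIntegral.norm_integral_le_integral_norm zero_le_one).trans_eq ?_
  simp only [norm_mul, norm_fchar, mul_one]

theorem fcoeff_partialX (hF : SmoothOnH F) (h : QuasiPeriodic ν F) (hy : 0 < y) :
    fcoeff ν (partialX F) y = 2 * Real.pi * Complex.I * ν * fcoeff ν F y := by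
  have hderiv : ∀ x, HasDerivAt (fun x => F (pt x y)) (partialX F (pt x y)) x := fun x => by
    rw [partialX_eq]; exact (hF.hasWirtingerAt _).hasDerivAt_re hy
  have hperiodic : F (pt 1 y) * fchar (-ν) 1 = F (pt 0 y) * fchar (-ν) 0 := by
    have hF1 := h.pt_add_one 0 hy
    have hfchar1 := fchar_add_one (-ν) 0
    rw [zero_add] at hF1 hfchar1
    rw [hF1, hfchar1]
    linear_combination F (pt 0 y) * fchar (-ν) 0 * expUnit_neg_mul ν
  have hparts := intervalIntegral.integral_deriv_mul_eq_sub (a := 0) (b := 1)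
    (fun x _ => hderiv x) (fun x _ => hasDerivAt_fchar (-ν) x)
    ((hF.partialX.continuous_pt hy).intervalIntegrable _ _)
    (((continuous_fchar (-ν)).const_mul _).intervalIntegrable _ _)
  have hzero : fcoeff ν (fun z => partialX F z + -(2 * Real.pi * Complex.I * ν) * F z) y = 0 := by
    rw [← sub_eq_zero.2 hperiodic, ← hparts]
    refine intervalIntegral.integral_congr fun x _ => ?_
    push_cast; ring
  rw [fcoeff_add hF.partialX (hF.const_mul _) _ hy, fcoeff_const_mul] at hzero
  linear_combination hzero

theorem fcoeff_dTau (hF : SmoothOnH F) (h : QuasiPeriodic ν F) (hy : 0 < y) :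
    fcoeff ν (dTau F) y =
      2 * Real.pi * Complex.I * ν * fcoeff ν F y - fcoeff ν (dTauBar F) y := by
  rw [← fcoeff_partialX hF h hy, funext (partialX_eq F), fcoeff_add hF.dTau hF.dTauBar _ hy]
  ring

theorem hasDerivAt_fcoeff_partialY (hF : SmoothOnH F) (ν : ℚ) (hy : 0 < y) :
    HasDerivAt (fcoeff ν F) (fcoeff ν (partialY F) y) y := by
  have hcont : ContinuousOn (fun p : ℝ × ℝ => partialY F (pt p.2 p.1) * fchar (-ν) p.2)
      (Set.Ioi 0 ×ˢ Set.univ) := by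
    refine ContinuousOn.mul ?_ (by fun_prop)
    exact hF.partialY.continuousOn.comp (f := fun p : ℝ × ℝ => (p.2 : ℂ) + p.1 * Complex.I)
      (by fun_prop) fun p hp => by simpa using hp.1
  refine hasDerivAt_intervalIntegral_of_continuousOn
    (f := fun y x => F (pt x y) * fchar (-ν) x)
    (f' := fun y x => partialY F (pt x y) * fchar (-ν) x) isOpen_Ioi hy
    (fun s hs => hF.continuous_mul_fchar (-ν) hs) hcont fun s hs x => ?_
  rw [partialY_eq]
  exact ((hF.hasWirtingerAt (pt x s)).hasDerivAt_im hs).mul_const _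

theorem hasDerivAt_fcoeff (hF : SmoothOnH F) (h : QuasiPeriodic ν F) (hy : 0 < y) :
    HasDerivAt (fcoeff ν F)
      (-(2 * Real.pi * ν) * fcoeff ν F y - 2 * Complex.I * fcoeff ν (dTauBar F) y) y := by
  refine (hasDerivAt_fcoeff_partialY hF ν hy).congr_deriv ?_
  have hY : partialY F = fun z => Complex.I * dTau F z + (-Complex.I) * dTauBar F z := by
    funext z; rw [partialY_eq]; ring
  rw [hY, fcoeff_add (hF.dTau.const_mul _) (hF.dTauBar.const_mul _) _ hy, fcoeff_const_mul,
    fcoeff_const_mul, fcoeff_dTau hF h hy]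
  linear_combination 2 * Real.pi * ν * fcoeff ν F y * Complex.I_sq

end FCoeff

/-! ### Convergence of Fourier series -/

theorem hasSum_fourier_of_periodic {φ : ℝ → ℂ} (hp : Function.Periodic φ 1) (hc : Continuous φ)
    (hs : Summable fun j : ℤ => ∫ x in (0 : ℝ)..1, φ x * fchar (-j) x) (x : ℝ) :
    HasSum (fun j : ℤ => (∫ x in (0 : ℝ)..1, φ x * fchar (-j) x) * fchar j x) (φ x) := by
  have : Fact ((0 : ℝ) < 1) := ⟨one_pos⟩
  let f : C(AddCircle (1 : ℝ), ℂ) := ⟨hp.lift, continuous_coinduced_dom.mpr hc⟩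
  have hf : ∀ x : ℝ, f (x : AddCircle (1 : ℝ)) = φ x := fun x => hp.lift_coe x
  have hfourier : ∀ (j : ℤ) (x : ℝ), fourier j (x : AddCircle (1 : ℝ)) = fchar j x :=
    fun j x => by rw [fourier_coe_apply, fchar]; push_cast; ring_nf
  have hcoeff : ∀ j : ℤ, fourierCoeff f j = ∫ x in (0 : ℝ)..1, φ x * fchar (-j) x := fun j => by
    rw [fourierCoeff_eq_intervalIntegral _ _ 0]
    simp only [hf, hfourier, zero_add, one_smul, div_one, smul_eq_mul]
    refine intervalIntegral.integral_congr fun x _ => ?_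
    simp only [Int.cast_neg]; ring
  have hsum := has_pointwise_sum_fourier_series_of_summable (f := f)
    (by simpa only [funext hcoeff] using hs) (x : AddCircle (1 : ℝ))
  simpa only [hcoeff, hf, hfourier, smul_eq_mul] using hsum

section Series

variable {q : ℚ} {F G : ℍ → ℂ} {y : ℝ}

theorem sq_mul_norm_fcoeff_le {ν : ℚ} (hF : SmoothOnH F) (h : QuasiPeriodic ν F) (hy : 0 < y) :
    |(ν : ℝ)| ^ 2 * ‖fcoeff ν F y‖ ≤ ∫ x in (0 : ℝ)..1, ‖partialX (partialX F) (pt x y)‖ := by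
  have hle := norm_fcoeff_le_integral (partialX (partialX F)) ν y
  rw [fcoeff_partialX hF.partialX (h.partialX hF) hy, fcoeff_partialX hF h hy, ← mul_assoc] at hle
  refine le_trans ?_ hle
  have hpi : 1 ≤ 2 * |Real.pi| := by rw [abs_of_pos Real.pi_pos]; linarith [Real.pi_gt_three]
  simp only [norm_mul, Complex.norm_I, Complex.norm_ratCast, Complex.norm_real,
    Complex.norm_ofNat, Real.norm_eq_abs]
  calc |(ν : ℝ)| ^ 2 * ‖fcoeff ν F y‖ ≤ (2 * |Real.pi|) ^ 2 * (|(ν : ℝ)| ^ 2 * ‖fcoeff ν F y‖) :=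
        le_mul_of_one_le_left (by positivity) (one_le_pow₀ hpi)
    _ = _ := by ring

theorem summable_fcoeff (hF : SmoothOnH F) (h : QuasiPeriodic q F) (hy : 0 < y) :
    Summable fun j : ℤ => fcoeff (j + q) F y := by
  set C := ∫ x in (0 : ℝ)..1, ‖partialX (partialX F) (pt x y)‖
  have hsq : Summable fun j : ℤ => C * (1 / |(j : ℝ) + q| ^ (2 : ℝ)) :=
    ((Real.summable_one_div_int_add_rpow q 2).2 one_lt_two).mul_left C
  refine Summable.of_norm_bounded_eventually hsq ?_
  have hne : ∀ᶠ j : ℤ in cofinite, (j : ℚ) + q ≠ 0 := by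
    refine Set.Finite.subset (Set.finite_singleton ⌊-q⌋) fun j hj => ?_
    have hj' : (j : ℚ) = -q := eq_neg_of_add_eq_zero_left (by simpa using hj)
    simp [← hj']
  filter_upwards [hne] with j hj
  have hle := sq_mul_norm_fcoeff_le hF (h.int_add j) hy
  have hpos : (0 : ℝ) < |(j : ℝ) + q| := abs_pos.2 (by exact_mod_cast hj)
  push_cast at hle
  rw [Real.rpow_two, mul_one_div, le_div_iff₀' (by positivity)]
  exact hle

theorem hasSum_fcoeff (hF : SmoothOnH F) (h : QuasiPeriodic q F) (hy : 0 < y) (x : ℝ) :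
    HasSum (fun j : ℤ => fcoeff (j + q) F y * fchar (j + q) x) (F (pt x y)) := by
  have hp : Function.Periodic (fun x => F (pt x y) * fchar (-q) x) 1 := fun x => by
    beta_reduce
    rw [h.pt_add_one x hy, fchar_add_one]
    linear_combination F (pt x y) * fchar (-q) x * expUnit_neg_mul q
  have hcoeff : ∀ j : ℤ, ∫ x in (0 : ℝ)..1, F (pt x y) * fchar (-q) x * fchar (-j) x =
      fcoeff (j + q) F y := fun j => by
    simp only [fcoeff, neg_add_rev, fchar_add, mul_assoc]
  have hsum := (hasSum_fourier_of_periodic hp (hF.continuous_mul_fchar _ hy)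
    (by simpa only [hcoeff] using summable_fcoeff hF h hy) x).mul_right (fchar q x)
  rw [mul_assoc, mul_comm (fchar (-q) x), fchar_mul_fchar_neg, mul_one] at hsum
  refine hsum.congr_fun fun j => ?_
  rw [hcoeff, fchar_add, mul_assoc]

theorem hasSum_integral_mul {ι : Type*} [Countable ι] {a : ι → ℂ} {e : ι → ℚ} {φ G : ℝ → ℂ}
    (hG : Continuous G) (ha : ∀ x, HasSum (fun i => a i * fchar (e i) x) (φ x)) :
    HasSum (fun i => a i * ∫ x in (0 : ℝ)..1, G x * fchar (e i) x)
      (∫ x in (0 : ℝ)..1, φ x * G x) := by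
  obtain ⟨C, hC⟩ := (isCompact_uIcc (a := (0 : ℝ)) (b := 1)).exists_bound_of_continuousOn
    hG.continuousOn
  have hsum : Summable fun i => ‖a i‖ * C :=
    Summable.mul_right C (by simpa [fchar] using (ha 0).summable.norm)
  simp only [← intervalIntegral.integral_const_mul]
  refine intervalIntegral.hasSum_integral_of_dominated_convergence (fun i _ => ‖a i‖ * C)
    (fun i => ?_) (fun i => ?_) (Eventually.of_forall fun _ _ => hsum) intervalIntegrable_const
    (Eventually.of_forall fun x _ => ?_)
  · exact Continuous.aestronglyMeasurable (by fun_prop)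
  · refine Eventually.of_forall fun x hx => ?_
    rw [norm_mul, norm_mul, norm_fchar, mul_one]
    exact mul_le_mul_of_nonneg_left (hC x (Set.uIoc_subset_uIcc hx)) (norm_nonneg _)
  · exact ((ha x).mul_right (G x)).congr_fun fun i => by ring

theorem hasSum_fcoeff_mul_fcoeff (hF : SmoothOnH F) (h : QuasiPeriodic q F) (hG : SmoothOnH G)
    (hy : 0 < y) : HasSum (fun j : ℤ => fcoeff (j + q) F y * fcoeff (-(j + q)) G y)
      (∫ x in (0 : ℝ)..1, F (pt x y) * G (pt x y)) := by
  simpa only [fcoeff, neg_neg] using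
    hasSum_integral_mul (hG.continuous_pt hy) (hasSum_fcoeff hF h hy)

theorem fcoeff_eq_of_hasSum {ν : ℚ} {a : ℚ → ℂ} (ha : ∀ n, a n ≠ 0 → ∃ j : ℤ, n = j + ν)
    (h : ∀ x, HasSum (fun n => a n * fchar n x) (F (pt x y))) : fcoeff ν F y = a ν := by
  refine (hasSum_integral_mul (continuous_fchar (-ν)) h).unique ?_
  have hself : ∫ x in (0 : ℝ)..1, fchar (-ν) x * fchar ν x = 1 := by
    simp only [mul_comm (fchar (-ν) _), fchar_mul_fchar_neg]; simp
  convert! hasSum_single ν (f := fun n => a n * ∫ x in (0 : ℝ)..1, fchar (-ν) x * fchar n x)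
    fun n hn => ?_ using 1
  · rw [hself, mul_one]
  by_cases h0 : a n = 0
  · rw [h0, zero_mul]
  · obtain ⟨j, rfl⟩ := ha n h0
    have hj : j ≠ 0 := by rintro rfl; simp at hn
    simp only [← fchar_add, neg_add_cancel_comm_assoc, integral_fchar_intCast, if_neg hj, mul_zero]

end Series

/-! ### Exponentials and the incomplete Gamma function -/

theorem eq_of_hasDerivAt_zero_of_pos {f : ℝ → ℂ} (h : ∀ y, 0 < y → HasDerivAt f 0 y) {x y : ℝ}
    (hx : 0 < x) (hy : 0 < y) : f x = f y :=
  isOpen_Ioi.is_const_of_deriv_eq_zero (s := Set.Ioi (0 : ℝ)) isPreconnected_Ioi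
    (fun z hz => (h z hz).differentiableAt.differentiableWithinAt) (fun z hz => (h z hz).deriv)
    hx hy

theorem eq_of_hasDerivAt_zero_of_tendsto {f : ℝ → ℂ} {c : ℂ}
    (h : ∀ y, 0 < y → HasDerivAt f 0 y) (hc : Tendsto f atTop (𝓝 c)) {y : ℝ} (hy : 0 < y) :
    f y = c := by
  refine tendsto_nhds_unique (tendsto_const_nhds.congr' ?_) hc
  filter_upwards [eventually_gt_atTop 0] with x hx using eq_of_hasDerivAt_zero_of_pos h hy hx

/-- The function `e^{2πνy}` of the height `y`, so that `e(ντ) = e^{-2πνy} e(νx)`. -/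
def expHeight (ν : ℚ) (y : ℝ) : ℂ := Complex.exp (2 * Real.pi * (ν : ℂ) * (y : ℂ))

theorem expHeight_add (ν μ : ℚ) (y : ℝ) : expHeight (ν + μ) y = expHeight ν y * expHeight μ y := by
  rw [expHeight, expHeight, expHeight, ← Complex.exp_add]
  push_cast
  ring_nf

theorem expHeight_mul_neg (ν : ℚ) (y : ℝ) : expHeight ν y * expHeight (-ν) y = 1 := by
  rw [← expHeight_add, add_neg_cancel, expHeight]
  simp

theorem expHeight_eq_ofReal (ν : ℚ) (y : ℝ) :
    expHeight ν y = (Real.exp (2 * Real.pi * ν * y) : ℝ) := by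
  rw [expHeight]
  push_cast
  rfl

theorem norm_expHeight (ν : ℚ) (y : ℝ) : ‖expHeight ν y‖ = Real.exp (2 * Real.pi * ν * y) := by
  rw [expHeight_eq_ofReal, Complex.norm_real, Real.norm_of_nonneg (Real.exp_pos _).le]

theorem hasDerivAt_expHeight (ν : ℚ) (y : ℝ) :
    HasDerivAt (expHeight ν) (2 * Real.pi * ν * expHeight ν y) y := by
  have hlin : HasDerivAt (fun y : ℝ => 2 * Real.pi * (ν : ℂ) * (y : ℂ)) (2 * Real.pi * ν) y :=
    ((Complex.ofRealCLM.hasDerivAt (x := y)).const_mul _).congr_deriv (by simp)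
  exact hlin.cexp.congr_deriv (mul_comm _ _)

theorem expTau_pt (ν : ℚ) (x : ℝ) {y : ℝ} (hy : 0 < y) :
    expTau ν (pt x y) = expHeight (-ν) y * fchar ν x := by
  rw [expTau, expHeight, fchar, ← Complex.exp_add, coe_pt x hy]
  congr 1
  push_cast
  linear_combination 2 * Real.pi * (ν : ℂ) * y * Complex.I_sq

theorem smoothOnH_expTau (ν : ℚ) : SmoothOnH (expTau ν) :=
  SmoothOnH.of_contDiffOn (f := fun z => Complex.exp (2 * Real.pi * Complex.I * (ν : ℂ) * z))
    (by fun_prop)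

theorem tendsto_pow_mul_exp_neg_mul (n : ℕ) {c : ℝ} (hc : 0 < c) :
    Tendsto (fun y : ℝ => y ^ n * Real.exp (-(c * y))) atTop (𝓝 0) := by
  have h := ((Real.tendsto_pow_mul_exp_neg_atTop_nhds_zero n).comp
    (tendsto_id.const_mul_atTop hc)).const_mul ((c ^ n)⁻¹)
  rw [mul_zero] at h
  refine h.congr fun y => ?_
  simp only [Function.comp_apply, id, mul_pow]
  field_simp

theorem tendsto_pow_mul_expHeight (n : ℕ) {ν : ℚ} (hν : ν < 0) :
    Tendsto (fun y : ℝ => (y : ℂ) ^ n * expHeight ν y) atTop (𝓝 0) := by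
  have hc : (0 : ℝ) < 2 * Real.pi * -ν :=
    mul_pos (by positivity) (by exact_mod_cast neg_pos.mpr hν)
  have h := (Complex.continuous_ofReal.tendsto 0).comp (tendsto_pow_mul_exp_neg_mul n hc)
  rw [Complex.ofReal_zero] at h
  refine h.congr fun y => ?_
  rw [expHeight_eq_ofReal, Function.comp_apply]
  push_cast
  ring_nf

theorem tendsto_expHeight {ν : ℚ} (hν : ν < 0) : Tendsto (expHeight ν) atTop (𝓝 0) := by
  simpa using tendsto_pow_mul_expHeight 0 hν

theorem incGamma_eq_sub_intervalIntegral {a x : ℝ} (ha : 0 < a) (hx : 0 ≤ x) :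
    incGamma a x = (∫ t in Set.Ioi (0 : ℝ), Real.exp (-t) * t ^ (a - 1)) -
      ∫ t in (0 : ℝ)..x, Real.exp (-t) * t ^ (a - 1) := by
  rw [← intervalIntegral.integral_Ioi_sub_Ioi (Real.GammaIntegral_convergent ha) hx, incGamma]
  ring

theorem hasDerivAt_incGamma {a x : ℝ} (ha : 0 < a) (hx : 0 < x) :
    HasDerivAt (incGamma a) (-(Real.exp (-x) * x ^ (a - 1))) x := by
  have hcont : ContinuousOn (fun t : ℝ => Real.exp (-t) * t ^ (a - 1)) (Set.Ioi 0) := fun t ht =>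
    ((Real.continuous_exp.comp continuous_neg).continuousAt.mul
      (Real.continuousAt_rpow_const t _ (Or.inl (ne_of_gt ht)))).continuousWithinAt
  have hint : HasDerivAt (fun u => ∫ t in (0 : ℝ)..u, Real.exp (-t) * t ^ (a - 1))
      (Real.exp (-x) * x ^ (a - 1)) x := by
    refine intervalIntegral.integral_hasDerivAt_right ?_
      (hcont.stronglyMeasurableAtFilter isOpen_Ioi x hx)
      (hcont.continuousAt (isOpen_Ioi.mem_nhds hx))
    rw [intervalIntegrable_iff_integrableOn_Ioc_of_le hx.le]
    exact (Real.GammaIntegral_convergent ha).mono_set Set.Ioc_subset_Ioi_self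
  refine (hint.const_sub (∫ t in Set.Ioi (0 : ℝ), Real.exp (-t) * t ^ (a - 1)))
    |>.congr_of_eventuallyEq ?_
  filter_upwards [isOpen_Ioi.mem_nhds hx] with u hu
    using incGamma_eq_sub_intervalIntegral ha (le_of_lt hu)

theorem tendsto_incGamma {a : ℝ} (ha : 0 < a) : Tendsto (incGamma a) atTop (𝓝 0) := by
  have h := (MeasureTheory.intervalIntegral_tendsto_integral_Ioi 0
    (Real.GammaIntegral_convergent ha) tendsto_id).const_sub
    (∫ t in Set.Ioi (0 : ℝ), Real.exp (-t) * t ^ (a - 1))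
  rw [sub_self] at h
  refine h.congr' ?_
  filter_upwards [eventually_ge_atTop 0] with u hu
    using (incGamma_eq_sub_intervalIntegral ha hu).symm

theorem tendsto_incGamma_mul {a c : ℝ} (ha : 0 < a) (hc : 0 < c) :
    Tendsto (fun y : ℝ => (incGamma a (c * y) : ℂ)) atTop (𝓝 0) := by
  have h := (Complex.continuous_ofReal.tendsto 0).comp
    ((tendsto_incGamma ha).comp (tendsto_id.const_mul_atTop hc))
  rwa [Complex.ofReal_zero] at h

/-! ### Two differential equations in the height -/

section HeightODE

variable {A : ℝ → ℂ} {C : ℂ} {ν : ℚ} {n : ℕ}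

theorem mul_exp_le_norm_sub_of_hasDerivAt (hν : 0 ≤ ν) (hC : C ≠ 0)
    (hA : ∀ y : ℝ, 0 < y → HasDerivAt A (C * ((y : ℂ) ^ n * expHeight (2 * ν) y)) y) {y : ℝ}
    (hy : 1 ≤ y) :
    Real.exp (2 * Real.pi * ν * (2 * y)) * y ≤ ‖A (2 * y) - A y‖ / ‖C‖ := by
  have : (0 : ℝ) ≤ 2 * Real.pi * ν := mul_nonneg (by positivity) (by exact_mod_cast hν)
  have hderiv : ∀ t : ℝ, 0 < t → HasDerivAt (fun t => (A t / C).re)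
      (t ^ n * Real.exp (2 * Real.pi * (2 * ν) * t)) t := fun t ht => by
    have h := ((hA t ht).div_const C).hasFDerivAt
    have hre := (Complex.reCLM.hasFDerivAt.comp t h).hasDerivAt
    refine hre.congr_deriv ?_
    rw [expHeight_eq_ofReal]
    simp only [ContinuousLinearMap.comp_apply, ContinuousLinearMap.toSpanSingleton_apply, one_smul,
      mul_div_cancel_left₀ _ hC, Complex.reCLM_apply]
    norm_cast
  have hmvt := (convex_Icc y (2 * y)).mul_sub_le_image_sub_of_le_deriv
    (f := fun t => (A t / C).re) (C := Real.exp (2 * Real.pi * ν * (2 * y)))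
    (fun t ht => (hderiv t (by linarith [ht.1])).continuousAt.continuousWithinAt)
    (fun t ht => by
      rw [interior_Icc] at ht
      exact (hderiv t (by linarith [ht.1])).differentiableAt.differentiableWithinAt)
    (fun t ht => by
      rw [interior_Icc] at ht
      rw [(hderiv t (by linarith [ht.1])).deriv]
      have hexp : 2 * Real.pi * ν * (2 * y) ≤ 2 * Real.pi * (2 * ν) * t := by nlinarith [ht.1]
      exact (Real.exp_le_exp.mpr hexp).trans
        (le_mul_of_one_le_left (Real.exp_pos _).le (one_le_pow₀ (by linarith [ht.1]))))
    y ⟨le_rfl, by linarith⟩ (2 * y) ⟨by linarith, le_rfl⟩ (by linarith)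
  calc _ = Real.exp (2 * Real.pi * ν * (2 * y)) * (2 * y - y) := by ring
    _ ≤ ((A (2 * y) - A y) / C).re := by rw [sub_div, Complex.sub_re]; exact hmvt
    _ ≤ _ := by rw [← norm_div]; exact Complex.re_le_norm _

theorem eq_zero_of_hasDerivAt_of_norm_le (hν : 0 ≤ ν)
    (hA : ∀ y : ℝ, 0 < y → HasDerivAt A (C * ((y : ℂ) ^ n * expHeight (2 * ν) y)) y) {K Y : ℝ}
    (hK : ∀ y, Y ≤ y → ‖A y‖ ≤ K * Real.exp (2 * Real.pi * ν * y)) : C = 0 := by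
  by_contra hC
  have hC' : 0 < ‖C‖ := norm_pos_iff.mpr hC
  have : (0 : ℝ) ≤ 2 * Real.pi * ν := mul_nonneg (by positivity) (by exact_mod_cast hν)
  have hK0 : 0 ≤ K :=
    nonneg_of_mul_nonneg_left ((norm_nonneg _).trans (hK Y le_rfl)) (Real.exp_pos _)
  obtain ⟨y, hYy, h1y, hy⟩ := ((eventually_ge_atTop Y).and
    ((eventually_ge_atTop 1).and (eventually_gt_atTop (2 * K / ‖C‖)))).exists
  have hbound : ‖A (2 * y) - A y‖ ≤ 2 * K * Real.exp (2 * Real.pi * ν * (2 * y)) :=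
    calc _ ≤ ‖A (2 * y)‖ + ‖A y‖ := norm_sub_le _ _
      _ ≤ K * Real.exp (2 * Real.pi * ν * (2 * y)) + K * Real.exp (2 * Real.pi * ν * y) :=
        add_le_add (hK _ (by linarith)) (hK y hYy)
      _ ≤ K * Real.exp (2 * Real.pi * ν * (2 * y)) + K * Real.exp (2 * Real.pi * ν * (2 * y)) := by
        gcongr; linarith
      _ = _ := by ring
  have hgrow := mul_exp_le_norm_sub_of_hasDerivAt hν hC hA h1y
  rw [le_div_iff₀ hC', mul_assoc, mul_comm] at hgrow
  have hle := le_of_mul_le_mul_right (hgrow.trans hbound) (Real.exp_pos _)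
  rw [div_lt_iff₀ hC'] at hy
  exact hle.not_gt hy

theorem eq_incGamma_of_hasDerivAt {p : ℂ} (hν : ν < 0)
    (hA : ∀ y : ℝ, 0 < y → HasDerivAt A (C * ((y : ℂ) ^ n * expHeight (2 * ν) y)) y)
    (hp : Tendsto A atTop (𝓝 p)) : ∃ c : ℂ, ∀ y, 0 < y →
      A y = p + c * (incGamma (n + 1) (4 * Real.pi * |(ν : ℝ)| * y) : ℂ) := by
  have hν' : (ν : ℝ) < 0 := by exact_mod_cast hν
  set s : ℝ := 4 * Real.pi * |(ν : ℝ)| with hs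
  have hs0 : 0 < s := mul_pos (by positivity) (abs_pos.mpr hν'.ne)
  have hn : (0 : ℝ) < n + 1 := by positivity
  have hsn : (s : ℂ) ^ (n + 1) ≠ 0 := pow_ne_zero _ (by exact_mod_cast hs0.ne')
  set c : ℂ := -(C / (s : ℂ) ^ (n + 1)) with hc
  have hderiv : ∀ y, 0 < y →
      HasDerivAt (fun y => A y - c * (incGamma (n + 1) (s * y) : ℂ)) 0 y := fun y hy => by
    have hΓ := ((hasDerivAt_incGamma hn (mul_pos hs0 hy)).comp y
      ((hasDerivAt_id y).const_mul s)).ofReal_comp.const_mul c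
    have hexp : Real.exp (-(s * y)) = Real.exp (2 * Real.pi * ((2 * ν : ℚ) : ℝ) * y) := by
      rw [hs, abs_of_neg hν']
      push_cast
      ring_nf
    refine ((hA y hy).sub hΓ).congr_deriv ?_
    rw [add_sub_cancel_right, Real.rpow_natCast, expHeight_eq_ofReal, hexp, hc]
    push_cast
    field_simp
    ring
  have hlim : Tendsto (fun y => A y - c * (incGamma (n + 1) (s * y) : ℂ)) atTop (𝓝 p) := by
    simpa using hp.sub ((tendsto_incGamma_mul hn hs0).const_mul c)
  exact ⟨c, fun y hy => by linear_combination eq_of_hasDerivAt_zero_of_tendsto hderiv hlim hy⟩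

end HeightODE

/-! ### The Fourier coefficients of a harmonic function -/

section HarmonicCoefficients

variable {ν : ℚ} {F : ℍ → ℂ} {n : ℕ} {P : ℚ →₀ ℂ}

theorem IsHarmonicNeg.hasDerivAt_fcoeff_dTauBar (hF : IsHarmonicNeg n F) (h : QuasiPeriodic ν F)
    {y : ℝ} (hy : 0 < y) :
    HasDerivAt (fcoeff ν (dTauBar F))
      ((2 * Real.pi * ν + n / y) * fcoeff ν (dTauBar F) y) y := by
  have hu := hF.smooth.dTauBar
  have hq := h.dTauBar hF.smooth
  have hdTau := fcoeff_dTau hu hq hy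
  rw [funext hF.dTau_dTauBar, fcoeff_mul_invTwoIY_mul _ _ hy] at hdTau
  have hy' : (y : ℂ) ≠ 0 := by exact_mod_cast hy.ne'
  have hI : (n : ℂ) / (2 * Complex.I * y) = -Complex.I / 2 * (n / y) := by
    field_simp
    simp
  rw [hI] at hdTau
  refine (hasDerivAt_fcoeff hu hq hy).congr_deriv ?_
  linear_combination -2 * Complex.I * hdTau - (4 * Real.pi * (ν : ℂ) + n / y) *
    fcoeff ν (dTauBar F) y * Complex.I_sq

theorem IsHarmonicNeg.exists_fcoeff_dTauBar_eq (hF : IsHarmonicNeg n F) (h : QuasiPeriodic ν F) :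
    ∃ β : ℂ, ∀ y, 0 < y → fcoeff ν (dTauBar F) y = β * (y : ℂ) ^ n * expHeight ν y := by
  have hderiv : ∀ y, 0 < y → HasDerivAt
      (fun y : ℝ => fcoeff ν (dTauBar F) y * (expHeight (-ν) y * ((y : ℂ)⁻¹) ^ n)) 0 y := by
    intro y hy
    have hy' : (y : ℂ) ≠ 0 := by exact_mod_cast hy.ne'
    have hinv : HasDerivAt (fun y : ℝ => ((y : ℂ)⁻¹) ^ n) (-(n / y) * ((y : ℂ)⁻¹) ^ n) y := by
      refine ((hasDerivAt_inv hy').comp_ofReal.pow n).congr_deriv ?_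
      cases n with
      | zero => simp
      | succ n => push_cast; rw [pow_succ _ n]; field_simp
    refine ((hF.hasDerivAt_fcoeff_dTauBar h hy).mul
      ((hasDerivAt_expHeight (-ν) y).mul hinv)).congr_deriv ?_
    simp only [Pi.mul_apply]
    push_cast
    ring
  refine ⟨fcoeff ν (dTauBar F) 1 * (expHeight (-ν) 1 * (((1 : ℝ) : ℂ)⁻¹) ^ n), fun y hy => ?_⟩
  rw [eq_of_hasDerivAt_zero_of_pos hderiv one_pos hy, inv_pow]
  have hy' : (y : ℂ) ^ n ≠ 0 := pow_ne_zero _ (by exact_mod_cast hy.ne')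
  field_simp
  linear_combination -fcoeff ν (dTauBar F) y * expHeight_mul_neg ν y

theorem hasDerivAt_fcoeff_mul_expHeight (hF : SmoothOnH F) (h : QuasiPeriodic ν F) {y : ℝ}
    (hy : 0 < y) : HasDerivAt (fun y => fcoeff ν F y * expHeight ν y)
      (-2 * Complex.I * (fcoeff ν (dTauBar F) y * expHeight ν y)) y := by
  refine ((hasDerivAt_fcoeff hF h hy).mul (hasDerivAt_expHeight ν y)).congr_deriv ?_
  ring

theorem IsHarmonicNeg.exists_hasDerivAt_fcoeff_mul_expHeight (hF : IsHarmonicNeg n F)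
    (h : QuasiPeriodic ν F) :
    ∃ C : ℂ, (∀ y, 0 < y → -2 * Complex.I * fcoeff ν (dTauBar F) y =
        C * ((y : ℂ) ^ n * expHeight ν y)) ∧
      ∀ y : ℝ, 0 < y → HasDerivAt (fun y => fcoeff ν F y * expHeight ν y)
        (C * ((y : ℂ) ^ n * expHeight (2 * ν) y)) y := by
  obtain ⟨β, hβ⟩ := hF.exists_fcoeff_dTauBar_eq h
  refine ⟨-2 * Complex.I * β, fun y hy => by rw [hβ y hy]; ring, fun y hy => ?_⟩
  refine (hasDerivAt_fcoeff_mul_expHeight hF.smooth h hy).congr_deriv ?_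
  rw [hβ y hy, two_mul ν, expHeight_add ν ν]
  ring

/-- The growth condition on a scalar function: up to an exponentially small error, `F` is the
finite sum of the terms `P n * e(nτ)`, with exponents `n` in `ℤ + ν`. -/
structure HasPrincipalPart (ν : ℚ) (F : ℍ → ℂ) (P : ℚ →₀ ℂ) : Prop where
  exists_int_add_eq : ∀ μ, P μ ≠ 0 → ∃ j : ℤ, μ = j + ν
  isBigO : ∃ ε : ℝ, 0 < ε ∧ (fun τ : ℍ => F τ - P.sum fun m a => a * expTau m τ)
    =O[atImInfty] fun τ : ℍ => Real.exp (-ε * τ.im)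

theorem HasPrincipalPart.int_add (h : HasPrincipalPart ν F P) (j : ℤ) :
    HasPrincipalPart (j + ν) F P where
  exists_int_add_eq μ hμ := by
    obtain ⟨i, rfl⟩ := h.exists_int_add_eq μ hμ
    exact ⟨i - j, by push_cast; ring⟩
  isBigO := h.isBigO

theorem fcoeff_finsuppSum (hP : ∀ μ, P μ ≠ 0 → ∃ j : ℤ, μ = j + ν) {y : ℝ} (hy : 0 < y) :
    fcoeff ν (fun τ => P.sum fun m a => a * expTau m τ) y = P ν * expHeight (-ν) y := by
  refine fcoeff_eq_of_hasSum (a := fun m => P m * expHeight (-m) y)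
    (fun m hm => hP m (left_ne_zero_of_mul hm)) fun x => ?_
  have hsum := hasSum_sum_of_ne_finset_zero (L := .unconditional ℚ)
    (f := fun m => P m * expHeight (-m) y * fchar m x) (s := P.support)
    fun m hm => by simp [Finsupp.notMem_support_iff.mp hm]
  convert! hsum using 1
  exact Finset.sum_congr rfl fun m _ => by beta_reduce; rw [expTau_pt m x hy, mul_assoc]

theorem HasPrincipalPart.norm_fcoeff_sub_le (hP : HasPrincipalPart ν F P) (hF : SmoothOnH F) :
    ∃ C ε : ℝ, 0 < ε ∧ ∀ᶠ y in atTop,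
      ‖fcoeff ν F y * expHeight ν y - P ν‖ ≤
        C * Real.exp (-(ε * y)) * Real.exp (2 * Real.pi * ν * y) := by
  obtain ⟨ε, hε, hO⟩ := hP.isBigO
  obtain ⟨C, hC⟩ := hO.bound
  rw [Filter.Eventually, atImInfty_mem] at hC
  obtain ⟨Y, hY⟩ := hC
  refine ⟨C, ε, hε, ?_⟩
  filter_upwards [eventually_ge_atTop Y, eventually_gt_atTop 0] with y hy hy0
  have hPs : SmoothOnH fun τ => P.sum fun m a => a * expTau m τ :=
    SmoothOnH.sum fun i _ => (smoothOnH_expTau i).const_mul _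
  have hle : ‖fcoeff ν (fun τ => F τ + (-1) * P.sum fun m a => a * expTau m τ) y‖ ≤
      C * Real.exp (-(ε * y)) := norm_fcoeff_le _ fun x => by
    have := hY (pt x y) (by rw [pt_im x hy0]; exact hy)
    simp only [Set.mem_ofPred_eq, pt_im x hy0, Real.norm_of_nonneg (Real.exp_pos _).le] at this
    rwa [neg_one_mul, ← sub_eq_add_neg, ← neg_mul]
  rw [fcoeff_add hF (hPs.const_mul _) _ hy0, fcoeff_const_mul,
    fcoeff_finsuppSum hP.exists_int_add_eq hy0] at hle
  rw [← norm_expHeight]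
  refine le_trans (le_of_eq ?_) (mul_le_mul_of_nonneg_right hle (norm_nonneg _))
  rw [← norm_mul]
  congr 1
  linear_combination P ν * expHeight_mul_neg ν y

theorem HasPrincipalPart.tendsto_fcoeff (hP : HasPrincipalPart ν F P) (hF : SmoothOnH F)
    (hν : ν ≤ 0) : Tendsto (fun y => fcoeff ν F y * expHeight ν y) atTop (𝓝 (P ν)) := by
  obtain ⟨C, ε, hε, hle⟩ := hP.norm_fcoeff_sub_le hF
  rw [tendsto_iff_norm_sub_tendsto_zero]
  have hlim : Tendsto (fun y : ℝ => |C| * Real.exp (-(ε * y))) atTop (𝓝 0) := by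
    simpa using (tendsto_pow_mul_exp_neg_mul 0 hε).const_mul |C|
  refine squeeze_zero' (Eventually.of_forall fun _ => norm_nonneg _) ?_ hlim
  filter_upwards [hle, eventually_ge_atTop 0] with y hle hy
  have hexp : Real.exp (2 * Real.pi * (ν : ℝ) * y) ≤ 1 := by
    have hν' : (ν : ℝ) ≤ 0 := by exact_mod_cast hν
    exact Real.exp_le_one_iff.mpr (mul_nonpos_of_nonpos_of_nonneg
      (mul_nonpos_of_nonneg_of_nonpos (by positivity) hν') hy)
  calc _ ≤ C * Real.exp (-(ε * y)) * Real.exp (2 * Real.pi * (ν : ℝ) * y) := hle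
    _ ≤ |C| * Real.exp (-(ε * y)) * 1 := by gcongr; exact le_abs_self C
    _ = _ := mul_one _

theorem HasPrincipalPart.exists_norm_fcoeff_mul_expHeight_le (hP : HasPrincipalPart ν F P)
    (hF : SmoothOnH F) (hν : 0 ≤ ν) : ∃ K Y : ℝ, ∀ y, Y ≤ y →
      ‖fcoeff ν F y * expHeight ν y‖ ≤ K * Real.exp (2 * Real.pi * ν * y) := by
  obtain ⟨C, ε, hε, hle⟩ := hP.norm_fcoeff_sub_le hF
  obtain ⟨Y, hY⟩ := eventually_atTop.mp (hle.and (eventually_ge_atTop 0))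
  refine ⟨|C| + ‖P ν‖, Y, fun y hy => ?_⟩
  obtain ⟨hle, hy0⟩ := hY y hy
  have hdecay : Real.exp (-(ε * y)) ≤ 1 := Real.exp_le_one_iff.mpr (by nlinarith)
  have hgrow : 1 ≤ Real.exp (2 * Real.pi * ν * y) := by
    have : (0 : ℝ) ≤ ν := by exact_mod_cast hν
    exact Real.one_le_exp_iff.mpr (by positivity)
  calc _ ≤ ‖fcoeff ν F y * expHeight ν y - P ν‖ + ‖P ν‖ := norm_le_norm_sub_add _ _
    _ ≤ C * Real.exp (-(ε * y)) * Real.exp (2 * Real.pi * ν * y) + ‖P ν‖ := by gcongr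
    _ ≤ |C| * 1 * Real.exp (2 * Real.pi * ν * y) + ‖P ν‖ * Real.exp (2 * Real.pi * ν * y) := by
      gcongr
      · exact le_abs_self C
      · exact le_mul_of_one_le_right (norm_nonneg _) hgrow
    _ = _ := by ring

theorem IsHarmonicNeg.fcoeff_dTauBar_eq_zero (hF : IsHarmonicNeg n F) (h : QuasiPeriodic ν F)
    (hP : HasPrincipalPart ν F P) (hν : 0 ≤ ν) {y : ℝ} (hy : 0 < y) :
    fcoeff ν (dTauBar F) y = 0 := by
  obtain ⟨C, hC, hderiv⟩ := hF.exists_hasDerivAt_fcoeff_mul_expHeight h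
  obtain ⟨K, Y, hK⟩ := hP.exists_norm_fcoeff_mul_expHeight_le hF.smooth hν
  have hzero := hC y hy
  rw [eq_zero_of_hasDerivAt_of_norm_le hν hderiv hK, zero_mul] at hzero
  simpa using hzero

theorem eq_mul_expHeight_neg {a c : ℂ} {y : ℝ} (h : a * expHeight ν y = c) :
    a = c * expHeight (-ν) y := by
  rw [← h, mul_assoc, expHeight_mul_neg, mul_one]

theorem IsHarmonicNeg.exists_fcoeff_eq_of_nonneg (hF : IsHarmonicNeg n F) (h : QuasiPeriodic ν F)
    (hP : HasPrincipalPart ν F P) (hν : 0 ≤ ν) :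
    ∃ c : ℂ, ∀ y, 0 < y → fcoeff ν F y = c * expHeight (-ν) y := by
  refine ⟨fcoeff ν F 1 * expHeight ν 1, fun y hy => eq_mul_expHeight_neg ?_⟩
  refine eq_of_hasDerivAt_zero_of_pos (f := fun y => fcoeff ν F y * expHeight ν y)
    (fun t ht => ?_) hy one_pos
  refine (hasDerivAt_fcoeff_mul_expHeight hF.smooth h ht).congr_deriv ?_
  rw [hF.fcoeff_dTauBar_eq_zero h hP hν ht, zero_mul, mul_zero]

theorem IsHarmonicNeg.exists_fcoeff_eq_of_neg (hF : IsHarmonicNeg n F) (h : QuasiPeriodic ν F)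
    (hP : HasPrincipalPart ν F P) (hν : ν < 0) :
    ∃ c : ℂ, ∀ y, 0 < y → fcoeff ν F y =
      (P ν + c * (incGamma (n + 1) (4 * Real.pi * |(ν : ℝ)| * y) : ℂ)) * expHeight (-ν) y := by
  obtain ⟨C, -, hderiv⟩ := hF.exists_hasDerivAt_fcoeff_mul_expHeight h
  obtain ⟨c, hc⟩ := eq_incGamma_of_hasDerivAt hν hderiv (hP.tendsto_fcoeff hF.smooth hν.le)
  exact ⟨c, fun y hy => eq_mul_expHeight_neg (hc y hy)⟩

end HarmonicCoefficients

/-! ### Fourier expansions of harmonic functions and of their derivatives -/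

theorem expTau_eq_expHeight_mul_fchar (ν : ℚ) (τ : ℍ) :
    expTau ν τ = expHeight (-ν) τ.im * fchar ν τ.re := by
  rw [← expTau_pt ν τ.re τ.im_pos, pt_re_im]

theorem injective_intCast_add (q : ℚ) : Function.Injective fun j : ℤ => (j + q : ℚ) :=
  fun i j h => by simpa using h

theorem hasSum_coset_iff {q : ℚ} {t : ℚ → ℂ} {s : ℂ} (ht : ∀ ν, t ν ≠ 0 → ∃ j : ℤ, ν = j + q) :
    HasSum (fun j : ℤ => t (j + q)) s ↔ HasSum t s :=
  (injective_intCast_add q).hasSum_iff fun ν hν => by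
    by_contra h
    obtain ⟨j, rfl⟩ := ht ν h
    exact hν ⟨j, rfl⟩

theorem exists_forall_coset {α : Type*} [Zero α] (q : ℚ) {r : ℚ → α → Prop}
    (h : ∀ j : ℤ, ∃ a, r (j + q) a) :
    ∃ c : ℚ → α, (∀ ν, c ν ≠ 0 → ∃ j : ℤ, ν = j + q) ∧ ∀ j : ℤ, r (j + q) (c (j + q)) := by
  classical
  choose a ha using h
  have hinj := injective_intCast_add q
  refine ⟨fun ν => if hν : ∃ j : ℤ, ν = j + q then a hν.choose else 0, fun ν hν => ?_, fun j => ?_⟩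
  · by_contra hcoset
    exact hν (dif_neg hcoset)
  · have hj : ∃ i : ℤ, (j + q : ℚ) = i + q := ⟨j, rfl⟩
    have hvalue : a hj.choose = a j := congrArg a (hinj hj.choose_spec).symm
    simpa only [dif_pos hj, hvalue] using ha j

section Expansions

variable {q ν : ℚ} {F G : ℍ → ℂ} {n : ℕ} {P : ℚ →₀ ℂ}

theorem hasSum_expTau_of_fcoeff_eq (hF : SmoothOnH F) (h : QuasiPeriodic q F) {c : ℚ → ℂ} {τ : ℍ}
    (hsupp : ∀ ν, c ν ≠ 0 → ∃ j : ℤ, ν = j + q)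
    (hc : ∀ j : ℤ, fcoeff (j + q) F τ.im = c (j + q) * expHeight (-(j + q)) τ.im) :
    HasSum (fun ν => c ν * expTau ν τ) (F τ) := by
  refine (hasSum_coset_iff fun ν hν => hsupp ν (left_ne_zero_of_mul hν)).mp ?_
  have hsum := hasSum_fcoeff hF h τ.im_pos τ.re
  rw [pt_re_im] at hsum
  refine hsum.congr_fun fun j => ?_
  rw [hc, expTau_eq_expHeight_mul_fchar, mul_assoc]

theorem IsHarmonicNeg.exists_maassCoefficients (hF : IsHarmonicNeg n F) (h : QuasiPeriodic q F)
    (hP : HasPrincipalPart q F P) :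
    ∃ cp cm : ℚ → ℂ, (∀ ν, cp ν ≠ 0 → ∃ j : ℤ, ν = j + q) ∧
      (∀ ν, cm ν ≠ 0 → ∃ j : ℤ, ν = j + q) ∧ (∀ ν, cm ν ≠ 0 → ν < 0) ∧
      (∀ ν < 0, cp ν ≠ 0 → P ν ≠ 0) ∧
      ∀ (j : ℤ) (y : ℝ), 0 < y → fcoeff (j + q) F y =
        (cp (j + q) + cm (j + q) *
          (incGamma (n + 1) (4 * Real.pi * |((j + q : ℚ) : ℝ)| * y) : ℂ)) *
            expHeight (-(j + q)) y := by
  obtain ⟨c, hsupp, hc⟩ := exists_forall_coset (α := ℂ × ℂ) q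
    (r := fun ν c => (c.2 ≠ 0 → ν < 0) ∧ (ν < 0 → c.1 = P ν) ∧ ∀ y, 0 < y → fcoeff ν F y =
      (c.1 + c.2 * (incGamma (n + 1) (4 * Real.pi * |(ν : ℝ)| * y) : ℂ)) * expHeight (-ν) y)
    fun j => by
      rcases le_or_gt 0 (j + q : ℚ) with hν | hν
      · obtain ⟨a, ha⟩ := hF.exists_fcoeff_eq_of_nonneg (h.int_add j) (hP.int_add j) hν
        exact ⟨(a, 0), fun h0 => absurd rfl h0, fun h0 => absurd h0 hν.not_gt,
          fun y hy => by rw [ha y hy, zero_mul, add_zero]⟩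
      · obtain ⟨b, hb⟩ := hF.exists_fcoeff_eq_of_neg (h.int_add j) (hP.int_add j) hν
        exact ⟨(P (j + q), b), fun _ => hν, fun _ => rfl, hb⟩
  refine ⟨fun ν => (c ν).1, fun ν => (c ν).2, fun ν h0 => hsupp ν fun hcν => h0 (by simp [hcν]),
    fun ν h0 => hsupp ν fun hcν => h0 (by simp [hcν]), fun ν h0 => ?_, fun ν hν h0 => ?_,
    fun j => (hc j).2.2⟩
  · obtain ⟨j, rfl⟩ := hsupp ν fun hcν => h0 (by simp [hcν])
    exact (hc j).1 h0
  · obtain ⟨j, rfl⟩ := hsupp ν fun hcν => h0 (by simp [hcν])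
    rwa [← (hc j).2.1 hν]

theorem IsHarmonicNeg.exists_maassExpansion (hF : IsHarmonicNeg n F) (h : QuasiPeriodic q F)
    (hP : HasPrincipalPart q F P) :
    ∃ cp cm : ℚ → ℂ, (∀ ν, cp ν ≠ 0 → ∃ j : ℤ, ν = j + q) ∧
      (∀ ν, cm ν ≠ 0 → ∃ j : ℤ, ν = j + q) ∧ (∀ ν, cm ν ≠ 0 → ν < 0) ∧
      (∀ ν < 0, cp ν ≠ 0 → P ν ≠ 0) ∧
      ∀ τ, ∃ a b : ℂ, HasSum (fun ν => cp ν * expTau ν τ) a ∧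
        HasSum (fun ν => cm ν * (incGamma (n + 1) (4 * Real.pi * |(ν : ℝ)| * τ.im) : ℂ) *
          expTau ν τ) b ∧ F τ = a + b := by
  obtain ⟨cp, cm, hcp, hcm, hneg, hprin, hcoeff⟩ := hF.exists_maassCoefficients h hP
  refine ⟨cp, cm, hcp, hcm, hneg, hprin, fun τ => ?_⟩
  have htotal := hasSum_expTau_of_fcoeff_eq hF.smooth h (c := fun ν => cp ν + cm ν *
    (incGamma (n + 1) (4 * Real.pi * |(ν : ℝ)| * τ.im) : ℂ)) (fun ν hν => by
      by_cases hcpν : cp ν = 0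
      · refine hcm ν fun hcmν => hν (by simp [hcpν, hcmν])
      · exact hcp ν hcpν) fun j => hcoeff j τ.im τ.im_pos
  -- Only finitely many terms with `ν < 0` are nonzero, and for `ν ≥ 0` the series agree.
  have hholo : Summable fun ν => cp ν * expTau ν τ := by
    refine (htotal.summable.indicator {ν | 0 ≤ ν}).congr_cofinite ?_
    filter_upwards [P.support.finite_toSet.compl_mem_cofinite] with ν hν
    rcases le_or_gt 0 ν with h0 | h0
    · have hcmν : cm ν = 0 := not_imp_comm.mp (hneg ν) h0.not_gt
      rw [Set.indicator_of_mem (by exact h0), hcmν, zero_mul, add_zero]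
    · have hcpν : cp ν = 0 := not_imp_comm.mp (hprin ν h0) (by simpa using hν)
      rw [Set.indicator_of_notMem (by exact h0.not_ge), hcpν, zero_mul]
  exact ⟨_, _, hholo.hasSum, (htotal.sub hholo.hasSum).congr_fun fun ν => by ring,
    (add_sub_cancel _ _).symm⟩

theorem exists_fcoeff_eq_of_dTauBar_eq_zero (hG : SmoothOnH G) (h : QuasiPeriodic ν G)
    (hhol : ∀ τ, dTauBar G τ = 0) :
    ∃ c : ℂ, ∀ y, 0 < y → fcoeff ν G y = c * expHeight (-ν) y := by
  have hderiv : ∀ y, 0 < y → HasDerivAt (fun y => fcoeff ν G y * expHeight ν y) 0 y :=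
    fun y hy => (hasDerivAt_fcoeff_mul_expHeight hG h hy).congr_deriv (by
      simp [funext hhol, fcoeff])
  exact ⟨fcoeff ν G 1 * expHeight ν 1, fun y hy =>
    eq_mul_expHeight_neg (eq_of_hasDerivAt_zero_of_pos hderiv hy one_pos)⟩

theorem tendsto_eval_inv (p : Polynomial ℂ) :
    Tendsto (fun y : ℝ => p.eval ((y : ℂ)⁻¹)) atTop (𝓝 (p.eval 0)) := by
  have hinv : Tendsto (fun y : ℝ => (y : ℂ)⁻¹) atTop (𝓝 0) := by
    have h := (Complex.continuous_ofReal.tendsto 0).comp tendsto_inv_atTop_zero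
    rw [Complex.ofReal_zero] at h
    exact h.congr fun y => by simp
  exact (p.continuous.tendsto 0).comp hinv

theorem IsHarmonicNeg.tendsto_fcoeff_iterate_dTau_dTauBar (hF : IsHarmonicNeg n F)
    (h : QuasiPeriodic ν F) (hν : ν < 0) (i : ℕ) :
    Tendsto (fun y => fcoeff ν (dTau^[i] (dTauBar F)) y * expHeight ν y) atTop (𝓝 0) := by
  obtain ⟨β, hβ⟩ := hF.exists_fcoeff_dTauBar_eq h
  let p : Polynomial ℂ := (Polynomial.C (2 * Complex.I)⁻¹ * Polynomial.X) ^ i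
  have hlim := ((tendsto_eval_inv p).mul (tendsto_pow_mul_expHeight n
    (by linarith : ν + ν < 0))).const_mul (n.descFactorial i * β)
  rw [mul_zero, mul_zero] at hlim
  refine hlim.congr' ?_
  filter_upwards [eventually_gt_atTop 0] with y hy
  have hfcoeff : fcoeff ν (dTau^[i] (dTauBar F)) y =
      n.descFactorial i * (p.eval ((y : ℂ)⁻¹) * fcoeff ν (dTauBar F) y) := by
    rw [iterate_dTau_of_dTau_eq hF.smooth.dTauBar hF.dTau_dTauBar, fcoeff_const_mul,
      ← fcoeff_const_mul (p.eval _)]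
    simp only [fcoeff, invTwoIY, twoIY_eq, pt_im _ hy, p, Polynomial.eval_pow, Polynomial.eval_mul,
      Polynomial.eval_C, Polynomial.eval_X, mul_inv]
  rw [hfcoeff, hβ y hy, expHeight_add]
  ring

theorem IsHarmonicNeg.tendsto_fcoeff_iterate_dTau (hF : IsHarmonicNeg n F)
    (h : QuasiPeriodic ν F) (hP : HasPrincipalPart ν F P) (hν : ν < 0) (i : ℕ) :
    Tendsto (fun y => fcoeff ν (dTau^[i] F) y * expHeight ν y) atTop
      (𝓝 ((2 * Real.pi * Complex.I * ν) ^ i * P ν)) := by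
  induction i with
  | zero => simpa using hP.tendsto_fcoeff hF.smooth hν.le
  | succ i ih =>
    have hlim := (ih.const_mul (2 * Real.pi * Complex.I * (ν : ℂ))).sub
      (hF.tendsto_fcoeff_iterate_dTau_dTauBar h hν i)
    rw [sub_zero, ← mul_assoc, ← pow_succ'] at hlim
    refine hlim.congr' ?_
    filter_upwards [eventually_gt_atTop 0] with y hy
    rw [Function.iterate_succ_apply', fcoeff_dTau (hF.smooth.iterate_dTau i)
      (h.iterate_dTau hF.smooth i) hy, dTauBar_iterate_dTau hF.smooth]
    ring

theorem IsHarmonicNeg.exists_fourierExpansion_iterate_dTau (hF : IsHarmonicNeg n F)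
    (h : QuasiPeriodic q F) (hP : HasPrincipalPart q F P) :
    ∃ c : ℚ → ℂ, (∀ ν, c ν ≠ 0 → ∃ j : ℤ, ν = j + q) ∧ (∀ ν < 0, c ν ≠ 0 → P ν ≠ 0) ∧
      ∀ τ, HasSum (fun ν => c ν * expTau ν τ) (dTau^[n + 1] F τ) := by
  have hG := hF.smooth.iterate_dTau (n + 1)
  have hq := h.iterate_dTau hF.smooth (n + 1)
  obtain ⟨c, hsupp, hc⟩ := exists_forall_coset q
    (r := fun ν c => ∀ y, 0 < y → fcoeff ν (dTau^[n + 1] F) y = c * expHeight (-ν) y)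
    fun j => exists_fcoeff_eq_of_dTauBar_eq_zero hG (hq.int_add j) hF.dTauBar_iterate_dTau_eq_zero
  refine ⟨c, hsupp, fun ν hν hcν hPν => hcν ?_,
    fun τ => hasSum_expTau_of_fcoeff_eq hG hq hsupp fun j => hc j τ.im τ.im_pos⟩
  obtain ⟨j, rfl⟩ := hsupp ν hcν
  have hlim := hF.tendsto_fcoeff_iterate_dTau (h.int_add j) (hP.int_add j) hν (n + 1)
  rw [hPν, mul_zero] at hlim
  refine tendsto_nhds_unique (tendsto_const_nhds.congr' ?_) hlim
  filter_upwards [eventually_gt_atTop 0] with y hy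
  rw [hc j y hy]
  linear_combination -c (j + q) * expHeight_mul_neg (j + q) y

end Expansions

/-! ### The contribution of one pair of Fourier coefficients -/

section Pairing

variable {ν : ℚ} {F G H : ℍ → ℂ} {n : ℕ} {P P' : ℚ →₀ ℂ} {y : ℝ}

theorem fcoeff_raise (hF : SmoothOnH F) (κ : ℂ) (ν : ℚ) (hy : 0 < y) :
    fcoeff ν (raise κ F) y = fcoeff ν (dTau F) y + κ / (2 * Complex.I * y) * fcoeff ν F y := by
  rw [← fcoeff_mul_invTwoIY_mul κ ν hy,
    ← fcoeff_add hF.dTau ((smoothOnH_invTwoIY.const_mul κ).mul hF) ν hy]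
  rfl

theorem hasDerivAt_fcoeff_of_raise (hG : SmoothOnH G) (h : QuasiPeriodic ν G) (κ : ℂ)
    (hy : 0 < y) :
    HasDerivAt (fcoeff ν G) ((2 * Real.pi * ν - κ / y) * fcoeff ν G y +
      2 * Complex.I * fcoeff ν (raise κ G) y) y := by
  refine (hasDerivAt_fcoeff hG h hy).congr_deriv ?_
  have hy' : (y : ℂ) ≠ 0 := by exact_mod_cast hy.ne'
  rw [fcoeff_raise hG κ ν hy, fcoeff_dTau hG h hy]
  field_simp
  linear_combination -4 * Real.pi * (ν : ℂ) * y * fcoeff ν G y * Complex.I_sq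

theorem hasDerivAt_fcoeff_pairing (hF : IsHarmonicNeg n F) (hqF : QuasiPeriodic ν F)
    (hG : SmoothOnH G) (hqG : QuasiPeriodic (-ν) G) (hhol : ∀ τ, dTauBar (raise n G) τ = 0)
    (hy : 0 < y) :
    HasDerivAt (fun y => fcoeff ν F y * fcoeff (-ν) (raise n G) y +
      fcoeff ν (dTauBar F) y * fcoeff (-ν) G y) 0 y := by
  have hraise := hasDerivAt_fcoeff (hG.raise n) (hqG.raise hG n) hy
  rw [funext hhol, show fcoeff (-ν) (fun _ => 0) y = 0 by simp [fcoeff]] at hraise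
  refine (((hasDerivAt_fcoeff hF.smooth hqF hy).mul hraise).add
    ((hF.hasDerivAt_fcoeff_dTauBar hqF hy).mul
      (hasDerivAt_fcoeff_of_raise hG hqG n hy))).congr_deriv ?_
  push_cast
  ring

theorem fcoeff_raise_of_hasDerivAt (hF : SmoothOnH F) (h : QuasiPeriodic ν F) (κ : ℂ) (hy : 0 < y)
    {X' : ℂ} (hX : HasDerivAt (fcoeff ν F) X' y) :
    fcoeff ν (raise κ F) y =
      Complex.I / 2 * ((2 * Real.pi * ν - κ / y) * fcoeff ν F y - X') := by
  rw [hX.unique (hasDerivAt_fcoeff_of_raise hF h κ hy)]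
  linear_combination fcoeff ν (raise κ F) y * Complex.I_sq

theorem exists_polynomial_fcoeff_raiseIter (hF : SmoothOnH F) (h : QuasiPeriodic ν F) {c : ℂ}
    (hc : ∀ y, 0 < y → fcoeff ν F y = c * expHeight (-ν) y) (κ : ℂ) (i : ℕ) :
    ∃ p : Polynomial ℂ, ∀ y, 0 < y →
      fcoeff ν (raiseIter κ i F) y = p.eval ((y : ℂ)⁻¹) * expHeight (-ν) y := by
  induction i with
  | zero => exact ⟨Polynomial.C c, fun y hy => by simpa [raiseIter] using hc y hy⟩
  | succ i ih =>
    obtain ⟨p, hp⟩ := ih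
    refine ⟨Polynomial.C (Complex.I / 2) * (Polynomial.C (4 * Real.pi * (ν : ℂ)) * p -
      Polynomial.C (κ + 2 * i) * Polynomial.X * p +
        Polynomial.X ^ 2 * Polynomial.derivative p), fun y hy => ?_⟩
    have hy' : (y : ℂ) ≠ 0 := by exact_mod_cast hy.ne'
    have hderiv : HasDerivAt (fcoeff ν (raiseIter κ i F))
        (p.derivative.eval ((y : ℂ)⁻¹) * -((y : ℂ) ^ 2)⁻¹ * expHeight (-ν) y +
          p.eval ((y : ℂ)⁻¹) * (2 * Real.pi * ((-ν : ℚ) : ℂ) * expHeight (-ν) y)) y :=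
      ((((p.hasDerivAt _).comp (y : ℂ) (hasDerivAt_inv hy')).comp_ofReal).mul
        (hasDerivAt_expHeight _ y)).congr_of_eventuallyEq
          ((eventually_gt_nhds hy).mono fun t ht => hp t ht)
    rw [raiseIter, fcoeff_raise_of_hasDerivAt (hF.raiseIter κ i) (h.raiseIter hF κ i) _ hy hderiv,
      hp y hy]
    simp only [Polynomial.eval_add, Polynomial.eval_sub, Polynomial.eval_mul, Polynomial.eval_C,
      Polynomial.eval_pow, Polynomial.eval_X]
    push_cast
    field_simp
    ring

theorem tendsto_fcoeff_dTauBar_mul_fcoeff_raiseIter (hF : IsHarmonicNeg n F)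
    (hqF : QuasiPeriodic ν F) (hH : IsHarmonicNeg n H) (hqH : QuasiPeriodic (-ν) H)
    (hP : HasPrincipalPart (-ν) H P) (hν : ν < 0) (κ : ℂ) (i : ℕ) :
    Tendsto (fun y => fcoeff ν (dTauBar F) y * fcoeff (-ν) (raiseIter κ i H) y) atTop (𝓝 0) := by
  obtain ⟨β, hβ⟩ := hF.exists_fcoeff_dTauBar_eq hqF
  obtain ⟨d, hd⟩ := hH.exists_fcoeff_eq_of_nonneg hqH hP (by linarith)
  obtain ⟨p, hp⟩ := exists_polynomial_fcoeff_raiseIter hH.smooth hqH hd κ i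
  have hlim := ((tendsto_pow_mul_expHeight n hν).const_mul β).mul
    ((tendsto_eval_inv p).mul (tendsto_expHeight hν))
  simp only [mul_zero] at hlim
  refine hlim.congr' ?_
  filter_upwards [eventually_gt_atTop 0] with y hy
  rw [hβ y hy, hp y hy, neg_neg]
  ring

theorem tendsto_fcoeff_mul_fcoeff_iterate_dTau {cp cm C : ℂ} (hν : ν < 0)
    (hF : ∀ y, 0 < y → fcoeff ν F y =
      (cp + cm * (incGamma (n + 1) (4 * Real.pi * |(ν : ℝ)| * y) : ℂ)) * expHeight (-ν) y)
    (hG : ∀ y, 0 < y → fcoeff (-ν) G y = C * expHeight ν y) :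
    Tendsto (fun y => fcoeff ν F y * fcoeff (-ν) G y) atTop (𝓝 (cp * C)) := by
  have hν' : (0 : ℝ) < |(ν : ℝ)| := abs_pos.mpr (by exact_mod_cast hν.ne)
  have hlim := (((tendsto_incGamma_mul (a := n + 1) (by positivity)
    (by positivity : 0 < 4 * Real.pi * |(ν : ℝ)|)).const_mul cm).const_add cp).mul_const C
  rw [mul_zero, add_zero] at hlim
  refine hlim.congr' ?_
  filter_upwards [eventually_gt_atTop 0] with y hy
  rw [hF y hy, hG y hy]
  linear_combination -C * (cp + cm * (incGamma (n + 1) (4 * Real.pi * |(ν : ℝ)| * y) : ℂ)) *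
    expHeight_mul_neg ν y

theorem fcoeff_pairing (hF : IsHarmonicNeg n F) (hqF : QuasiPeriodic ν F)
    (hPF : HasPrincipalPart ν F P') (hH : IsHarmonicNeg n H) (hqH : QuasiPeriodic (-ν) H)
    (hPH : HasPrincipalPart (-ν) H P) {cp cm C : ℂ} (hcm : cm ≠ 0 → ν < 0)
    (hcF : ∀ y, 0 < y → fcoeff ν F y =
      (cp + cm * (incGamma (n + 1) (4 * Real.pi * |(ν : ℝ)| * y) : ℂ)) * expHeight (-ν) y)
    (hC : ∀ y, 0 < y → fcoeff (-ν) (dTau^[n + 1] H) y = C * expHeight ν y) (hy : 0 < y) :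
    fcoeff ν F y * fcoeff (-ν) (dTau^[n + 1] H) y +
      fcoeff ν (dTauBar F) y * fcoeff (-ν) (raiseIter (-n) n H) y = cp * C := by
  rcases le_or_gt 0 ν with hν | hν
  · rw [hF.fcoeff_dTauBar_eq_zero hqF hPF hν hy, hcF y hy, hC y hy,
      not_imp_comm.mp hcm hν.not_gt]
    linear_combination cp * C * expHeight_mul_neg ν y
  · have hG := raise_raiseIter_neg hH.smooth n
    have hderiv : ∀ y, 0 < y → HasDerivAt (fun y => fcoeff ν F y * fcoeff (-ν) (dTau^[n + 1] H) y +
        fcoeff ν (dTauBar F) y * fcoeff (-ν) (raiseIter (-n) n H) y) 0 y := fun y hy => by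
      rw [← hG]
      refine hasDerivAt_fcoeff_pairing hF hqF (hH.smooth.raiseIter _ _)
        (hqH.raiseIter hH.smooth _ _) ?_ hy
      rw [hG]
      exact hH.dTauBar_iterate_dTau_eq_zero
    have hlim := (tendsto_fcoeff_mul_fcoeff_iterate_dTau hν hcF hC).add
      (tendsto_fcoeff_dTauBar_mul_fcoeff_raiseIter hF hqF hH hqH hPH hν (-n) n)
    rw [add_zero] at hlim
    exact eq_of_hasDerivAt_zero_of_tendsto hderiv hlim hy

theorem hasSum_coefficients_mul {q : ℚ} (hF : IsHarmonicNeg n F) (hqF : QuasiPeriodic q F)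
    (hPF : HasPrincipalPart q F P') (hH : IsHarmonicNeg n H) (hqH : QuasiPeriodic (-q) H)
    (hPH : HasPrincipalPart (-q) H P) {cp cm C : ℚ → ℂ} (hcm : ∀ ν, cm ν ≠ 0 → ν < 0)
    (hcF : ∀ (j : ℤ) (y : ℝ), 0 < y → fcoeff (j + q) F y =
      (cp (j + q) + cm (j + q) * (incGamma (n + 1) (4 * Real.pi * |((j + q : ℚ) : ℝ)| * y) : ℂ)) *
        expHeight (-(j + q)) y)
    (hC : ∀ (j : ℤ) (y : ℝ), 0 < y →
      fcoeff (j + -q) (dTau^[n + 1] H) y = C (j + -q) * expHeight (-(j + -q)) y) (hy : 0 < y) :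
    HasSum (fun j : ℤ => cp (j + q) * C (-(j + q)))
      (∫ x in (0 : ℝ)..1, (F (pt x y) * dTau^[n + 1] H (pt x y) +
        dTauBar F (pt x y) * raiseIter (-n) n H (pt x y))) := by
  have hGs := hH.smooth.iterate_dTau (n + 1)
  have hRs := hH.smooth.raiseIter (-n) n
  have hqF' := hqF.dTauBar hF.smooth
  rw [intervalIntegral.integral_add
    (((hF.smooth.mul hGs).continuous_pt hy).intervalIntegrable _ _)
    (((hF.smooth.dTauBar.mul hRs).continuous_pt hy).intervalIntegrable _ _)]
  refine ((hasSum_fcoeff_mul_fcoeff hF.smooth hqF hGs hy).add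
    (hasSum_fcoeff_mul_fcoeff hF.smooth.dTauBar hqF' hRs hy)).congr_fun fun j => ?_
  have hneg : ((-j : ℤ) + -q : ℚ) = -(j + q) := by push_cast; ring
  have hqH' := hqH.int_add (-j)
  have hPH' := hPH.int_add (-j)
  have hCj := hC (-j)
  rw [hneg] at hqH' hPH' hCj
  rw [neg_neg] at hCj
  exact (fcoeff_pairing hF (hqF.int_add j) (hPF.int_add j) hH hqH' hPH' (hcm _) (hcF j) hCj
    hy).symm

end Pairing

/-! ### Vector valued forms -/

theorem Mp2Z.exists_mat_eq (M : SL(2, ℤ)) : ∃ g : Mp2Z, g.mat = M := by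
  let π : Mp2Z →* SL(2, ℤ) := ⟨⟨Mp2Z.mat, rfl⟩, fun _ _ => rfl⟩
  have hsurj : (Subgroup.closure {Mp2Z.S, Mp2Z.T}).map π = ⊤ := by
    rw [MonoidHom.map_closure, Set.image_pair]
    exact SpecialLinearGroup.SL2Z_generators
  obtain ⟨g, -, hg⟩ : M ∈ (Subgroup.closure {Mp2Z.S, Mp2Z.T}).map π := by rw [hsurj]; trivial
  exact ⟨g, hg⟩

section Vector

variable {D : Type*} {q : D → ℚ} {n : ℕ} {f h : ℍ → D → ℂ} {P P' : D → ℚ →₀ ℂ}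

/-- The properties of a harmonic weak Maass form of weight `-n` that concern its components one
at a time: each is harmonic, quasi-periodic, and asymptotic to its Fourier polynomial `P γ`. -/
structure IsHarmonicVector (q : D → ℚ) (n : ℕ) (f : ℍ → D → ℂ) (P : D → ℚ →₀ ℂ) : Prop where
  isHarmonicNeg : ∀ γ, IsHarmonicNeg n fun z => f z γ
  quasiPeriodic : ∀ γ, QuasiPeriodic (q γ) fun z => f z γ
  hasPrincipalPart : ∀ γ, HasPrincipalPart (q γ) (fun z => f z γ) (P γ)

theorem TransformsBy.quasiPeriodic [Fintype D] [DecidableEq D] {k : ℤ}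
    (hf : TransformsBy ModularGroup.T (Matrix.diagonal fun γ => expUnit (q γ)) k f) (γ : D) :
    QuasiPeriodic (q γ) fun z => f z γ := fun τ => by
  beta_reduce
  rw [hf τ γ, denom_modularGroup_T, one_zpow, one_mul, Matrix.mulVec_diagonal]

theorem IsHarmonicMaass.exists_isHarmonicVector [Fintype D] [DecidableEq D]
    {R : Mp2Z → Matrix D D ℂ → Prop} (hf : IsHarmonicMaass R q (-n) f)
    (hT : R Mp2Z.T (Matrix.diagonal fun γ => expUnit (q γ))) :
    ∃ P, IsHarmonicVector q n f P := by
  obtain ⟨P, hP, ε, hε, hO⟩ := hf.growth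
  exact ⟨P, fun γ => isHarmonicNeg_of_hypLaplacian_eq_zero (hf.smooth γ) (hf.harmonic γ),
    (isModular_iff_transformsBy.mp hf.modular _ _ hT).quasiPeriodic,
    fun γ => ⟨fun μ hμ => (hP γ μ hμ).1, ε, hε, hO γ⟩⟩

theorem suppBddBelow_of_neg_imp [Finite D] {c : D → ℚ → ℂ}
    (h : ∀ γ, ∀ ν < 0, c γ ν ≠ 0 → P γ ν ≠ 0) : SuppBddBelow c := by
  have := Fintype.ofFinite D
  classical
  obtain ⟨N, hN⟩ := (insert 0 (Finset.univ.biUnion fun γ => (P γ).support)).bddBelow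
  refine ⟨N, fun γ ν hν => ?_⟩
  rcases le_or_gt 0 ν with h0 | h0
  · exact (hN (by simp)).trans h0
  · refine hN ?_
    simp only [Finset.coe_insert, Finset.coe_biUnion]
    exact Or.inr (Set.mem_biUnion (Finset.mem_coe.mpr (Finset.mem_univ γ))
      (by simpa using h γ ν h0 hν))

theorem natCast_add_one_eq (n : ℕ) : (n + 1 : ℝ) = ((1 - -(n : ℤ) : ℤ) : ℝ) := by
  push_cast; ring

theorem iterate_opD (hf : ∀ γ, SmoothOnH fun z => f z γ) (i : ℕ) :
    opD^[i] f = fun τ γ =>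
      (1 / (2 * Real.pi * Complex.I)) ^ i * dTau^[i] (fun z => f z γ) τ := by
  induction i with
  | zero => simp
  | succ i ih =>
    rw [Function.iterate_succ_apply', ih]
    funext τ γ
    change 1 / (2 * Real.pi * Complex.I) * dTau (fun z => (1 / (2 * Real.pi * Complex.I)) ^ i *
      dTau^[i] (fun z => f z γ) z) τ = _
    rw [dTau_const_mul _ ((hf γ).iterate_dTau i), Function.iterate_succ_apply']
    ring

theorem TransformsBy.iterate_dTau_apply [Fintype D] {M : SL(2, ℤ)} {A : Matrix D D ℂ}
    (hf : TransformsBy M A (-n) f) (hs : ∀ γ, SmoothOnH fun z => f z γ) :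
    TransformsBy M A (n + 2) fun τ γ => dTau^[n + 1] (fun z => f z γ) τ := by
  have hbol : ∀ γ, raiseIter ((-n : ℤ) : ℂ) (n + 1) (fun z => f z γ) =
      dTau^[n + 1] fun z => f z γ := fun γ => by
    rw [← bol_identity (hs γ)]
    congr 1
    push_cast
    ring
  have hraise := hf.raiseIter_apply hs (n + 1)
  simp only [hbol] at hraise
  rwa [show (-n + 2 * (n + 1 : ℕ) : ℤ) = n + 2 by push_cast; ring] at hraise

namespace IsHarmonicVector

theorem exists_hasMaassExpansion [Finite D] (hf : IsHarmonicVector q n f P) :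
    ∃ cp cm, HasMaassExpansion q (-n) f cp cm := by
  choose cp cm hcp hcm hneg hprincipal hsum using fun γ =>
    (hf.isHarmonicNeg γ).exists_maassExpansion (hf.quasiPeriodic γ) (hf.hasPrincipalPart γ)
  refine ⟨cp, cm, hcp, suppBddBelow_of_neg_imp hprincipal, hcm, hneg, fun τ γ => ?_⟩
  rw [← natCast_add_one_eq]
  exact hsum γ τ

theorem exists_hasFourierExpansion_opD [Finite D] (hf : IsHarmonicVector q n f P) :
    ∃ c, HasFourierExpansion q (opD^[n + 1] f) c := by
  choose a hcoset hprincipal hsum using fun γ =>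
    (hf.isHarmonicNeg γ).exists_fourierExpansion_iterate_dTau (hf.quasiPeriodic γ)
      (hf.hasPrincipalPart γ)
  rw [iterate_opD fun γ => (hf.isHarmonicNeg γ).smooth]
  refine ⟨fun γ ν => (1 / (2 * Real.pi * Complex.I)) ^ (n + 1) * a γ ν,
    fun γ ν hν => hcoset γ ν (right_ne_zero_of_mul hν),
    suppBddBelow_of_neg_imp fun γ ν h0 hν => hprincipal γ ν h0 (right_ne_zero_of_mul hν),
    fun τ γ => ?_⟩
  simpa only [mul_assoc] using (hsum γ τ).mul_left ((1 / (2 * Real.pi * Complex.I)) ^ (n + 1))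

theorem isWeaklyHolomorphic_opD [Fintype D] {R : Mp2Z → Matrix D D ℂ → Prop}
    (hf : IsHarmonicVector q n f P) (hmod : IsModular R (-n) f) :
    IsWeaklyHolomorphic R q (2 - -n) (opD^[n + 1] f) := by
  have hs := fun γ => (hf.isHarmonicNeg γ).smooth
  have hopD := iterate_opD hs (n + 1)
  refine ⟨fun γ => ?_, ?_, hf.exists_hasFourierExpansion_opD⟩
  · rw [hopD]
    refine mdifferentiable_of_dTauBar_eq_zero (((hs γ).iterate_dTau _).const_mul _) fun τ => ?_
    rw [((((hs γ).iterate_dTau _).hasWirtingerAt τ).const_mul _).dTauBar_eq,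
      (hf.isHarmonicNeg γ).dTauBar_iterate_dTau_eq_zero, mul_zero]
  · rw [hopD, isModular_iff_transformsBy, sub_neg_eq_add, add_comm]
    exact fun g A hA =>
      ((isModular_iff_transformsBy.mp hmod g A hA).iterate_dTau_apply hs).const_mul _

end IsHarmonicVector

theorem HasMaassExpansion.fcoeff_eq {cp cm : D → ℚ → ℂ} (hf : HasMaassExpansion q (-n) f cp cm)
    (γ : D) (j : ℤ) {y : ℝ} (hy : 0 < y) : fcoeff (j + q γ) (fun z => f z γ) y =
      (cp γ (j + q γ) + cm γ (j + q γ) *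
        (incGamma (n + 1) (4 * Real.pi * |((j + q γ : ℚ) : ℝ)| * y) : ℂ)) *
          expHeight (-(j + q γ)) y := by
  refine fcoeff_eq_of_hasSum (a := fun ν => (cp γ ν + cm γ ν *
    (incGamma (n + 1) (4 * Real.pi * |(ν : ℝ)| * y) : ℂ)) * expHeight (-ν) y)
    (fun ν hν => ?_) fun x => ?_
  · have hcoset : ∃ i : ℤ, ν = i + q γ := by
      by_cases hcp : cp γ ν = 0
      · exact hf.suppCoset_neg γ ν fun hcm => hν (by simp [hcp, hcm])
      · exact hf.suppCoset_pos γ ν hcp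
    obtain ⟨i, rfl⟩ := hcoset
    exact ⟨i - j, by push_cast; ring⟩
  · obtain ⟨a, b, ha, hb, hab⟩ := hf.expansion (pt x y) γ
    rw [hab]
    rw [← natCast_add_one_eq] at hb
    refine (ha.add hb).congr_fun fun ν => ?_
    rw [expTau_pt ν x hy, pt_im x hy]
    ring

theorem HasFourierExpansion.fcoeff_eq {c : D → ℚ → ℂ} (hf : HasFourierExpansion q f c) (γ : D)
    (j : ℤ) {y : ℝ} (hy : 0 < y) :
    fcoeff (j + q γ) (fun z => f z γ) y = c γ (j + q γ) * expHeight (-(j + q γ)) y := by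
  refine fcoeff_eq_of_hasSum (a := fun ν => c γ ν * expHeight (-ν) y) (fun ν hν => ?_)
    fun x => ?_
  · obtain ⟨i, rfl⟩ := hf.suppCoset γ ν (left_ne_zero_of_mul hν)
    exact ⟨i - j, by push_cast; ring⟩
  · refine (hf.hasSum (pt x y) γ).congr_fun fun ν => ?_
    rw [expTau_pt ν x hy, mul_assoc]

theorem finite_support_mul_neg {a b : D → ℚ → ℂ} (ha : SuppCoset q a) (ha' : SuppBddBelow a)
    (hb : SuppBddBelow b) (γ : D) : (Function.support fun m => a γ m * b γ (-m)).Finite := by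
  obtain ⟨N, hN⟩ := ha'
  obtain ⟨N', hN'⟩ := hb
  refine ((Set.finite_Icc ⌈N - q γ⌉ ⌊-N' - q γ⌋).image fun j : ℤ => (j + q γ : ℚ)).subset
    fun m hm => ?_
  have hbm := right_ne_zero_of_mul hm
  obtain ⟨j, rfl⟩ := ha γ m (left_ne_zero_of_mul hm)
  refine ⟨j, ⟨Int.ceil_le.mpr ?_, Int.le_floor.mpr ?_⟩, rfl⟩
  · linarith [hN γ _ (left_ne_zero_of_mul hm)]
  · linarith [hN' γ _ hbm]

namespace IsHarmonicVector

theorem finsum_coefficients_mul (hf : IsHarmonicVector q n f P)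
    (hh : IsHarmonicVector (fun γ => -q γ) n h P') {cp cm cg : D → ℚ → ℂ}
    (hcf : HasMaassExpansion q (-n) f cp cm)
    (hcg : HasFourierExpansion (fun γ => -q γ) (opD^[n + 1] h) cg) (γ : D) {y : ℝ} (hy : 0 < y) :
    ∑ᶠ m : ℚ, cp γ m * cg γ (-m) = (1 / (2 * Real.pi * Complex.I)) ^ (n + 1) *
      ∫ x in (0 : ℝ)..1, (f (pt x y) γ * dTau^[n + 1] (fun z => h z γ) (pt x y) +
        dTauBar (fun z => f z γ) (pt x y) * raiseIter (-n) n (fun z => h z γ) (pt x y)) := by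
  set c : ℂ := (1 / (2 * Real.pi * Complex.I)) ^ (n + 1) with hc
  have hc0 : c ≠ 0 := pow_ne_zero _ (one_div_ne_zero Complex.two_pi_I_ne_zero)
  have hcoeff : ∀ (j : ℤ) (y : ℝ), 0 < y → fcoeff (j + -q γ) (dTau^[n + 1] fun z => h z γ) y =
      c⁻¹ * cg γ (j + -q γ) * expHeight (-(j + -q γ)) y := fun j y hy => by
    have hG := hcg.fcoeff_eq γ j hy
    rw [iterate_opD fun γ => (hh.isHarmonicNeg γ).smooth, ← hc, fcoeff_const_mul] at hG
    rw [mul_assoc, ← hG, inv_mul_cancel_left₀ hc0]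
  have hsum := hasSum_coefficients_mul (C := fun ν => c⁻¹ * cg γ ν) (hf.isHarmonicNeg γ)
    (hf.quasiPeriodic γ) (hf.hasPrincipalPart γ) (hh.isHarmonicNeg γ) (hh.quasiPeriodic γ)
    (hh.hasPrincipalPart γ) (hcf.neg_of_ne_zero γ) (fun j y => hcf.fcoeff_eq γ j) hcoeff hy
  rw [← tsum_eq_finsum (L := .unconditional ℚ)
    (finite_support_mul_neg hcf.suppCoset_pos hcf.bddBelow_pos hcg.bddBelow γ)]
  refine HasSum.tsum_eq ((hasSum_coset_iff fun m hm =>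
    hcf.suppCoset_pos γ m (left_ne_zero_of_mul hm)).mp
      ((hsum.mul_left c).congr_fun fun j => ?_))
  field_simp

theorem sum_finsum_coefficients_mul_eq_zero [Fintype D] [DecidableEq D]
    (hf : IsHarmonicVector q n f P) (hh : IsHarmonicVector (fun γ => -q γ) n h P')
    (hmod : ∀ M : SL(2, ℤ), ∃ A A' : Matrix D D ℂ, A.transpose * A' = 1 ∧
      TransformsBy M A (-n) f ∧ TransformsBy M A' (-n) h) {cp cm cg : D → ℚ → ℂ}
    (hcf : HasMaassExpansion q (-n) f cp cm)
    (hcg : HasFourierExpansion (fun γ => -q γ) (opD^[n + 1] h) cg) :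
    ∑ γ, ∑ᶠ m : ℚ, cp γ m * cg γ (-m) = 0 := by
  have hfs := fun γ => (hf.isHarmonicNeg γ).smooth
  have hhs := fun γ => (hh.isHarmonicNeg γ).smooth
  have hraise := fun γ => raise_raiseIter_neg (hhs γ) n
  have hintegral := integral_pairing_eq_zero hf.isHarmonicNeg
    (g := fun τ γ => raiseIter (-n) n (fun z => h z γ) τ) (fun γ => (hhs γ).raiseIter _ _)
    (fun γ τ => by rw [hraise, (hh.isHarmonicNeg γ).dTauBar_iterate_dTau_eq_zero])
    (fun M => by
      obtain ⟨A, A', hA, hfM, hhM⟩ := hmod M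
      have hG := hhM.raiseIter_apply hhs n
      push_cast at hG
      rw [show (-n + 2 * n : ℤ) = n by ring] at hG
      exact ⟨A, A', hA, hfM, hG⟩) one_pos
  simp only [hraise, ← Finset.sum_add_distrib] at hintegral
  rw [intervalIntegral.integral_finsetSum fun γ _ =>
    ((((hfs γ).mul ((hhs γ).iterate_dTau (n + 1))).add
      ((hfs γ).dTauBar.mul ((hhs γ).raiseIter (-n) n))).continuous_pt
        one_pos).intervalIntegrable _ _] at hintegral
  rw [Finset.sum_congr rfl fun γ _ => hf.finsum_coefficients_mul hh hcf hcg γ one_pos,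
    ← Finset.mul_sum, hintegral, mul_zero]

end IsHarmonicVector

end Vector

/-! ### The orthogonality relation -/

namespace EvenLattice

variable {V : Type*} [AddCommGroup V] [Module ℚ V] (Λ : EvenLattice V)

theorem weilRel_T : Λ.WeilRel Mp2Z.T (Matrix.diagonal fun γ => expUnit (Λ.q γ)) :=
  ⟨Λ.weilT, Subgroup.subset_closure (by simp), rfl⟩

theorem dualWeilRel_T : Λ.DualWeilRel Mp2Z.T (Matrix.diagonal fun γ => expUnit (-Λ.q γ)) := by
  refine ⟨Λ.weilT, Subgroup.subset_closure (by simp), ?_⟩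
  change _ = (star (Matrix.diagonal fun γ => expUnit (Λ.q γ))).transpose
  rw [Matrix.star_eq_conjTranspose, Matrix.diagonal_conjTranspose, Matrix.diagonal_transpose]
  exact congrArg _ (funext fun γ => expUnit_neg _)

theorem exists_weilRel_dualWeilRel (g : Mp2Z) :
    ∃ A A', A.transpose * A' = 1 ∧ Λ.WeilRel g A ∧ Λ.DualWeilRel g A' := by
  obtain ⟨U, hU⟩ := Λ.exists_mem_weilGraph g
  refine ⟨_, _, ?_, ⟨U, hU, rfl⟩, ⟨U, hU, rfl⟩⟩
  have hinv : ((U⁻¹ : Matrix.unitaryGroup Λ.Disc ℂ) : Matrix Λ.Disc Λ.Disc ℂ) * U = 1 :=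
    congrArg Subtype.val (inv_mul_cancel U)
  rw [← Matrix.transpose_mul, hinv, Matrix.transpose_one]

end EvenLattice

theorem mainTheorem2_general {D : Type*} [Fintype D] [DecidableEq D]
    {R R' : Mp2Z → Matrix D D ℂ → Prop} {q : D → ℚ}
    (hT : R Mp2Z.T (Matrix.diagonal fun γ => expUnit (q γ)))
    (hT' : R' Mp2Z.T (Matrix.diagonal fun γ => expUnit (-q γ)))
    (hdual : ∀ g, ∃ A A', A.transpose * A' = 1 ∧ R g A ∧ R' g A')
    (k : ℤ) (hk : k ≤ 0) (f g : ℍ → D → ℂ) (hf : IsHarmonicMaass R q k f)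
    (hg : g ∈ opD^[(1 - k).toNat] '' {h | IsHarmonicMaass R' (fun γ => -q γ) k h}) :
    IsWeaklyHolomorphic R' (fun γ => -q γ) (2 - k) g ∧
    (∃ cp cm, HasMaassExpansion q k f cp cm) ∧
    ∀ cp cm cg, HasMaassExpansion q k f cp cm → HasFourierExpansion (fun γ => -q γ) g cg →
      ∑ γ, ∑ᶠ m : ℚ, cp γ m * cg γ (-m) = 0 := by
  obtain ⟨n, rfl⟩ : ∃ n : ℕ, k = -n := ⟨(-k).toNat, by omega⟩
  obtain ⟨h, hh, rfl⟩ := hg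
  rw [show (1 - -(n : ℤ)).toNat = n + 1 by omega]
  obtain ⟨Pf, hPf⟩ := hf.exists_isHarmonicVector hT
  obtain ⟨Ph, hPh⟩ := IsHarmonicMaass.exists_isHarmonicVector hh hT'
  refine ⟨hPh.isWeaklyHolomorphic_opD hh.modular, hPf.exists_hasMaassExpansion,
    fun cp cm cg => hPf.sum_finsum_coefficients_mul_eq_zero hPh fun M => ?_⟩
  obtain ⟨g, rfl⟩ := Mp2Z.exists_mat_eq M
  obtain ⟨A, A', hA, hR, hR'⟩ := hdual g
  exact ⟨A, A', hA, isModular_iff_transformsBy.mp hf.modular g A hR,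
    isModular_iff_transformsBy.mp hh.modular g A' hR'⟩

end

theorem mainTheorem2 {V : Type*} [AddCommGroup V] [Module ℚ V] (Λ : EvenLattice V)
    (k : ℤ) (hk : k ≤ 0) (f g : ℍ → Λ.Disc → ℂ) (hf : f ∈ Λ.H k)
    (hg : g ∈ opD^[(1 - k).toNat] '' Λ.HDual k) :
    g ∈ Λ.MDual (2 - k) ∧
    (∃ cp cm, HasMaassExpansion Λ.q k f cp cm) ∧
    ∀ cp cm cg, HasMaassExpansion Λ.q k f cp cm →
      HasFourierExpansion (fun γ => -Λ.q γ) g cg →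
      ∑ γ, ∑ᶠ m : ℚ, cp γ m * cg γ (-m) = 0 :=
  mainTheorem2_general Λ.weilRel_T Λ.dualWeilRel_T Λ.exists_weilRel_dualWeilRel k hk f g hf hg
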